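/- Let $\gamma,\gamma_0,q\in L^\infty(0,\pi)$ be real-valued with $\operatorname{ess\,inf}_{(0,\pi)}\gamma>0$, let $p\in W^{1,\infty}(0,\pi)$ be real-valued, and let $\omega\subset(0,\pi)$ be a non-empty open set. All operators act in complex $L^2$ spaces. Let $$\mathfrak L u=-(\gamma u')'+\gamma_0u,\qquad \mathcal D(\mathfrak L)=\{u\in H^1_0(0,\pi):\ \mathfrak L u\in L^2(0,\pi)\},$$ and let $\Lambda$ be the set of eigenvalues of $\mathfrak L$. On $\mathcal D(\mathcal A^*)=\mathcal D(\mathfrak L)^2\subset L^2(0,\pi)^2$ put $$\mathcal A^*\begin{pmatrix}u_1\\u_2\end{pmatrix}=\begin{pmatrix}\mathfrak L u_1+q\,u_2-(p\,u_2)'\\ \mathfrak L u_2\end{pmatrix}.$$ 1. The spectrum of $\mathcal A^*$ is exactly $\Lambda$, which is also the spectrum of $\mathfrak L$, and every point of the spectrum of $\mathcal A^*$ is an eigenvalue of $\mathcal A^*$. Let $\lambda\in\Lambda$. There is a real-valued eigenfunction $\phi_\lambda$ of $\mathfrak L$ for $\lambda$ with $\|\phi_\lambda\|_{L^2(0,\pi)}=1$.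 For any such $\phi_\lambda$, put $$I_\lambda=\int_0^\pi\Bigl(q-\tfrac12p'\Bigr)\phi_\lambda^2\,dx.$$ There is exactly one $\psi_\lambda\in\mathcal D(\mathfrak L)$ with $$\mathfrak L\psi_\lambda-\lambda\psi_\lambda=(p\phi_\lambda)'-q\phi_\lambda+I_\lambda\phi_\lambda\quad\text{and}\quad\int_\omega\phi_\lambda\psi_\lambda\,dx=0.$$ Put $\Phi_\lambda=\begin{pmatrix}\phi_\lambda\\0\end{pmatrix}$ and $\Psi_\lambda=\begin{pmatrix}\psi_\lambda\\\phi_\lambda\end{pmatrix}$. 2. $\dim\ker(\mathcal A^*-\lambda)=1$ if and only if $I_\lambda\ne0$. In that case $\Phi_\lambda$ is an eigenfunction of $\mathcal A^*$ for $\lambda$, and $\Psi_\lambda$ is a generalized eigenfunction of $\mathcal A^*$ for $\lambda$ (that is, $(\mathcal A^*-\lambda)\Psi_\lambda$ is an eigenfunction for $\lambda$), with $$(\mathcal A^*-\lambda)\Phi_\lambda=0,\qquad(\mathcal A^*-\lambda)\Psi_\lambda=I_\lambda\Phi_\lambda.$$ 3. $\dim\ker(\mathcal A^*-\lambda)=2$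 if and only if $I_\lambda=0$. In that case $\Phi_\lambda$ and $\Psi_\lambda$ are both eigenfunctions of $\mathcal A^*$ for $\lambda$: $(\mathcal A^*-\lambda)\Phi_\lambda=0$ and $(\mathcal A^*-\lambda)\Psi_\lambda=0$. -/

import Mathlib

open MeasureTheory Set
open scoped ENNReal Distributions

noncomputable section

/-! ### Unbounded operators on a complex normed space -/

namespace UnboundedOp

variable {E : Type*} [NormedAddCommGroup E] [NormedSpace ℂ E]

/-- `z` is in the resolvent set of `T` if `T - z : dom T → E` has a bounded two-sided inverse. -/
def resolventSet (T : E →ₗ.[ℂ] E) : Set ℂ :=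
  {z | ∃ R : E →L[ℂ] E,
    (∀ y : E, ∃ h : R y ∈ T.domain, T ⟨R y, h⟩ - z • R y = y) ∧
    ∀ x : T.domain, R (T x - z • (x : E)) = x}

/-- The spectrum of `T`. -/
def spectrum (T : E →ₗ.[ℂ] E) : Set ℂ := (resolventSet T)ᶜ

/-- The kernel of `T - z`, as a subspace of `E`. -/
def eigenspace (T : E →ₗ.[ℂ] E) (z : ℂ) : Submodule ℂ E :=
  (LinearMap.ker (T.toFun - z • T.domain.subtype)).map T.domain.subtype

/-- `x` is a nonzero element of the domain of `T` with `T x = z x`. -/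
def IsEigenvector (T : E →ₗ.[ℂ] E) (z : ℂ) (x : E) : Prop :=
  x ∈ eigenspace T z ∧ x ≠ 0

/-- The set of eigenvalues of `T`. -/
def eigenvalues (T : E →ₗ.[ℂ] E) : Set ℂ := {z | ∃ x, IsEigenvector T z x}

/-- `x` is in the domain of `T` and `(T - z) x` is an eigenvector of `T` for `z`; in particular
`(T - z) x ≠ 0` and `(T - z)² x = 0`. -/
def IsGeneralizedEigenvector (T : E →ₗ.[ℂ] E) (z : ℂ) (x : E) : Prop :=
  ∃ h : x ∈ T.domain, IsEigenvector T z (T ⟨x, h⟩ - z • x)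

/-- The geometric multiplicity of `z`, that is `dim ker (T - z)` (`0` if it is infinite). -/
def geometricMultiplicity (T : E →ₗ.[ℂ] E) (z : ℂ) : ℕ := Module.finrank ℂ (eigenspace T z)

end UnboundedOp

namespace Cascade

/-! ### Function spaces on `(0, π)` -/

/-- The interval `(0, π)`. -/
def Ω : TopologicalSpace.Opens ℝ := ⟨Ioo 0 Real.pi, isOpen_Ioo⟩

/-- Lebesgue measure on `(0, π)`. -/
abbrev μ : Measure ℝ := volume.restrict (Ioo 0 Real.pi)

/-- Complex `L²(0, π)`. -/
abbrev L2 : Type := Lp ℂ 2 μ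

/-- Real `L²(0, π)`. -/
abbrev L2R : Type := Lp ℝ 2 μ

/-- Real `L^∞(0, π)`. -/
abbrev LInf : Type := Lp ℝ ∞ μ

/-- The product `L²(0, π)²` with its Hilbert space structure. -/
abbrev L2Pair : Type := WithLp 2 (L2 × L2)

/-- The function `a u`, for `a ∈ L^∞(0, π)` and `u ∈ L²(0, π)`. -/
def coeffMul (a : LInf) (u : L2) : L2 := (a • u : Lp ℂ 2 μ)

/-- A real function in `L²(0, π)`, seen as a complex one. -/
def toComplex (u : L2R) : L2 := Complex.ofRealCLM.compLp u

/-- `g` is the derivative of `f` in the sense of distributions on `(0, π)`.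
It is used for functions `f`, `g` in `L²(0, π)` or in `L^∞(0, π)`. -/
def IsWeakDeriv {F : Type*} [NormedAddCommGroup F] [NormedSpace ℝ F] (f g : ℝ → F) : Prop :=
  ∀ θ : 𝓓(Ω, ℝ), ∫ x, deriv θ x • f x ∂μ = - ∫ x, θ x • g x ∂μ

theorem memLp_testFunction {F : Type*} [NormedAddCommGroup F] [NormedSpace ℝ F]
    (θ : 𝓓(Ω, F)) : MemLp θ 2 μ :=
  (map_continuous θ).memLp_of_hasCompactSupport θ.hasCompactSupport

theorem continuous_deriv_testFunction {F : Type*} [NormedAddCommGroup F] [NormedSpace ℝ F]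
    (θ : 𝓓(Ω, F)) : Continuous (deriv θ) :=
  θ.contDiff.continuous_deriv (by simp)

theorem memLp_deriv_testFunction {F : Type*} [NormedAddCommGroup F] [NormedSpace ℝ F]
    (θ : 𝓓(Ω, F)) : MemLp (deriv θ) 2 μ :=
  (continuous_deriv_testFunction θ).memLp_of_hasCompactSupport θ.hasCompactSupport.deriv

theorem differentiable_testFunction {F : Type*} [NormedAddCommGroup F] [NormedSpace ℝ F]
    (θ : 𝓓(Ω, F)) : Differentiable ℝ θ :=
  θ.contDiff.differentiable (by simp)

/-- The linear map `θ ↦ (θ, θ')` from `C_c^∞(0, π)` to `L²(0, π) × L²(0, π)`. -/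
def testPair : 𝓓(Ω, ℂ) →ₗ[ℂ] L2 × L2 where
  toFun θ := ((memLp_testFunction θ).toLp θ, (memLp_deriv_testFunction θ).toLp (deriv θ))
  map_add' θ η := by
    ext1
    · exact MemLp.toLp_add (memLp_testFunction θ) (memLp_testFunction η)
    · refine (MemLp.toLp_congr (memLp_deriv_testFunction (θ + η)) ((memLp_deriv_testFunction θ).add
        (memLp_deriv_testFunction η)) ?_).trans
        (MemLp.toLp_add (memLp_deriv_testFunction θ) (memLp_deriv_testFunction η))
      refine Filter.Eventually.of_forall fun x => ?_
      exact deriv_add (differentiable_testFunction θ x) (differentiable_testFunction η x)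
  map_smul' c θ := by
    ext1
    · exact MemLp.toLp_const_smul c (memLp_testFunction θ)
    · refine (MemLp.toLp_congr (memLp_deriv_testFunction (c • θ))
        ((memLp_deriv_testFunction θ).const_smul c) ?_).trans
        (MemLp.toLp_const_smul c (memLp_deriv_testFunction θ))
      refine Filter.Eventually.of_forall fun x => ?_
      exact deriv_const_smul c (differentiable_testFunction θ x)

/-- The space `H¹₀(0, π)`, as the space of pairs `(u, u')`: the closure of the pairs `(θ, θ')`,
`θ ∈ C_c^∞(0, π)`, in the norm of `H¹(0, π)`. -/
def H10 : Submodule ℂ (L2 × L2) := (LinearMap.range testPair).topologicalClosure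

/-! ### Facts that show that the operators below are well defined -/

theorem integrable_test_smul {p : ℝ≥0∞} [Fact (1 ≤ p)] {F : Type*} [NormedAddCommGroup F]
    [NormedSpace ℝ F] (θ : 𝓓(Ω, ℝ)) (f : Lp F p μ) : Integrable (fun x => θ x • f x) μ := by
  obtain ⟨C, hC⟩ := (map_continuous θ).bounded_above_of_compact_support θ.hasCompactSupport
  exact ((Lp.memLp f).integrable Fact.out).bdd_smul C
    (map_continuous θ).aestronglyMeasurable (Filter.Eventually.of_forall hC)

theorem integrable_deriv_test_smul {p : ℝ≥0∞} [Fact (1 ≤ p)] {F : Type*} [NormedAddCommGroup F]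
    [NormedSpace ℝ F] (θ : 𝓓(Ω, ℝ)) (f : Lp F p μ) : Integrable (fun x => deriv θ x • f x) μ := by
  obtain ⟨C, hC⟩ := (continuous_deriv_testFunction θ).bounded_above_of_compact_support
    θ.hasCompactSupport.deriv
  exact ((Lp.memLp f).integrable Fact.out).bdd_smul C
    (continuous_deriv_testFunction θ).aestronglyMeasurable (Filter.Eventually.of_forall hC)

theorem IsWeakDeriv.add {f₁ f₂ g₁ g₂ : L2} (h₁ : IsWeakDeriv f₁ g₁) (h₂ : IsWeakDeriv f₂ g₂) :
    IsWeakDeriv (f₁ + f₂ : L2) (g₁ + g₂ : L2) := by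
  intro θ
  have e₁ : ∫ x, deriv θ x • (f₁ + f₂ : L2) x ∂μ
      = ∫ x, deriv θ x • f₁ x ∂μ + ∫ x, deriv θ x • f₂ x ∂μ := by
    rw [← integral_add (integrable_deriv_test_smul θ f₁) (integrable_deriv_test_smul θ f₂)]
    refine integral_congr_ae ?_
    filter_upwards [Lp.coeFn_add f₁ f₂] with x hx
    rw [hx, Pi.add_apply, smul_add]
  have e₂ : ∫ x, θ x • (g₁ + g₂ : L2) x ∂μ
      = ∫ x, θ x • g₁ x ∂μ + ∫ x, θ x • g₂ x ∂μ := by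
    rw [← integral_add (integrable_test_smul θ g₁) (integrable_test_smul θ g₂)]
    refine integral_congr_ae ?_
    filter_upwards [Lp.coeFn_add g₁ g₂] with x hx
    rw [hx, Pi.add_apply, smul_add]
  rw [e₁, e₂, h₁ θ, h₂ θ]; ring

theorem IsWeakDeriv.smul (c : ℂ) {f g : L2} (h : IsWeakDeriv f g) :
    IsWeakDeriv (c • f : L2) (c • g : L2) := by
  intro θ
  have e₁ : ∫ x, deriv θ x • (c • f : L2) x ∂μ = c * ∫ x, deriv θ x • f x ∂μ := by
    rw [← integral_const_mul]
    refine integral_congr_ae ?_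
    filter_upwards [Lp.coeFn_smul c f] with x hx
    rw [hx, Pi.smul_apply, smul_comm, smul_eq_mul]
  have e₂ : ∫ x, θ x • (c • g : L2) x ∂μ = c * ∫ x, θ x • g x ∂μ := by
    rw [← integral_const_mul]
    refine integral_congr_ae ?_
    filter_upwards [Lp.coeFn_smul c g] with x hx
    rw [hx, Pi.smul_apply, smul_comm, smul_eq_mul]
  rw [e₁, e₂, h θ]; ring

theorem isWeakDeriv_zero : IsWeakDeriv (0 : L2) (0 : L2) := by
  intro θ
  have e (η : ℝ → ℝ) : ∫ x, η x • (0 : L2) x ∂μ = 0 := by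
    rw [← integral_zero ℝ ℂ (μ := μ)]
    refine integral_congr_ae ?_
    filter_upwards [Lp.coeFn_zero ℂ 2 μ] with x hx
    rw [hx, Pi.zero_apply, smul_zero]
  rw [e, e, neg_zero]

/-- The zero function has only the zero function as weak derivative. -/
theorem IsWeakDeriv.eq_zero {g : L2} (h : IsWeakDeriv (0 : L2) g) : g = 0 := by
  have hi : Integrable g μ := (Lp.memLp g).integrable one_le_two
  have key := isOpen_Ioo.ae_eq_zero_of_integral_contDiff_smul_eq_zero (μ := volume)
    (U := Ioo 0 Real.pi) (f := g) (IntegrableOn.locallyIntegrableOn hi) (by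
      intro θ h₁ h₂ h₃
      have hz : ∫ x, θ x • g x ∂μ = 0 := by
        have h₀ := h ⟨θ, h₁, h₂, h₃⟩
        have h₀' := isWeakDeriv_zero ⟨θ, h₁, h₂, h₃⟩
        rw [h₀, neg_inj] at h₀'
        refine h₀'.trans ?_
        rw [← integral_zero ℝ ℂ (μ := μ)]
        refine integral_congr_ae ?_
        filter_upwards [Lp.coeFn_zero ℂ 2 μ] with x hx
        rw [hx, Pi.zero_apply, smul_zero]
      rw [← hz, eq_comm]
      refine setIntegral_eq_integral_of_forall_compl_eq_zero fun x hx => ?_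
      rw [image_eq_zero_of_notMem_tsupport (fun hx' => hx (h₃ hx')), zero_smul])
  rw [Lp.eq_zero_iff_ae_eq_zero]
  exact (ae_restrict_iff' measurableSet_Ioo).2 key

theorem integral_smul_eq_inner {η : ℝ → ℝ} (hη : MemLp (fun x => (η x : ℂ)) 2 μ) (f : L2) :
    ∫ x, η x • f x ∂μ = inner ℂ (hη.toLp _) f := by
  rw [L2.inner_def]
  refine integral_congr_ae ?_
  filter_upwards [hη.coeFn_toLp] with x hx
  rw [hx, RCLike.inner_apply, Complex.conj_ofReal, mul_comm, Complex.real_smul]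

/-- If `(u, v)` is in `H¹₀(0, π)`, then `v` is the weak derivative of `u`. -/
theorem isWeakDeriv_of_mem_H10 {w : L2 × L2} (hw : w ∈ H10) : IsWeakDeriv w.1 w.2 := by
  intro θ
  have h₁ : MemLp (fun x => Complex.ofReal (deriv θ x)) 2 μ := (memLp_deriv_testFunction θ).ofReal
  have h₀ : MemLp (fun x => (θ x : ℂ)) 2 μ := (memLp_testFunction θ).ofReal
  have hcl : IsClosed {w : L2 × L2 |
      inner ℂ (h₁.toLp _) w.1 = - inner ℂ (h₀.toLp _) w.2} :=
    isClosed_eq (by fun_prop) (by fun_prop)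
  rw [integral_smul_eq_inner h₁, integral_smul_eq_inner h₀]
  refine closure_minimal ?_ hcl hw
  rintro _ ⟨η, rfl⟩
  change inner ℂ (h₁.toLp _) ((memLp_testFunction η).toLp η)
    = - inner ℂ (h₀.toLp _) ((memLp_deriv_testFunction η).toLp (deriv η))
  rw [← integral_smul_eq_inner h₁, ← integral_smul_eq_inner h₀]
  have i₁ : ∫ x, deriv θ x • ((memLp_testFunction η).toLp η) x ∂μ
      = ∫ x, deriv θ x • η x := by
    rw [← setIntegral_eq_integral_of_forall_compl_eq_zero (s := Ioo 0 Real.pi)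
      (f := fun x => deriv θ x • η x)]
    · refine integral_congr_ae ?_
      filter_upwards [(memLp_testFunction η).coeFn_toLp] with x hx
      rw [hx]
    · intro x hx
      rw [image_eq_zero_of_notMem_tsupport (fun hx' => hx (η.tsupport_subset hx')), smul_zero]
  have i₂ : ∫ x, θ x • ((memLp_deriv_testFunction η).toLp (deriv η)) x ∂μ
      = ∫ x, θ x • deriv η x := by
    rw [← setIntegral_eq_integral_of_forall_compl_eq_zero (s := Ioo 0 Real.pi)
      (f := fun x => θ x • deriv η x)]
    · refine integral_congr_ae ?_
      filter_upwards [(memLp_deriv_testFunction η).coeFn_toLp] with x hx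
      rw [hx]
    · intro x hx
      rw [image_eq_zero_of_notMem_tsupport (fun hx' => hx (θ.tsupport_subset hx')), zero_smul]
  rw [i₁, i₂, eq_neg_iff_add_eq_zero, add_comm, ← eq_neg_iff_add_eq_zero]
  exact integral_bilinear_hasDerivAt_right_eq_neg_left_of_integrable
    (L := (ContinuousLinearMap.lsmul ℝ ℝ : ℝ →L[ℝ] ℂ →L[ℝ] ℂ))
    (u := θ) (u' := deriv θ) (v := η) (v' := deriv η)
    (fun x _ => (differentiable_testFunction θ x).hasDerivAt)
    (fun x _ => (differentiable_testFunction η x).hasDerivAt)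
    (((map_continuous θ).smul (continuous_deriv_testFunction η)).integrable_of_hasCompactSupport
      θ.hasCompactSupport.smul_right)
    (((continuous_deriv_testFunction θ).smul (map_continuous η)).integrable_of_hasCompactSupport
      θ.hasCompactSupport.deriv.smul_right)
    (((map_continuous θ).smul (map_continuous η)).integrable_of_hasCompactSupport
      θ.hasCompactSupport.smul_right)

theorem coeffMul_add (a : LInf) (u v : L2) : coeffMul a (u + v) = coeffMul a u + coeffMul a v :=
  Lp.add_smul a u v

theorem coeffMul_smul (c : ℂ) (a : LInf) (u : L2) : coeffMul a (c • u) = c • coeffMul a u := by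
  refine Lp.ext ?_
  filter_upwards [Lp.coeFn_lpSMul (r := 2) a (c • u), Lp.coeFn_lpSMul (r := 2) a u,
    Lp.coeFn_smul c u, Lp.coeFn_smul c (coeffMul a u)] with x h₁ h₂ h₃ h₄
  rw [h₄, Pi.smul_apply]
  refine h₁.trans ?_
  rw [Pi.smul_apply', h₃, Pi.smul_apply, smul_comm]
  exact congrArg (c • ·) h₂.symm

theorem coeffMul_zero (a : LInf) : coeffMul a 0 = 0 := Lp.smul_zero ℂ 2 a

/-! ### The operators -/

/-- The graph of the scalar operator: pairs `(u, f)` with `u ∈ H¹₀(0, π)`, `f ∈ L²(0, π)` and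
`-(γ u')' + γ₀ u = f` in the sense of distributions on `(0, π)`. -/
def scalarGraph (γ γ₀ : LInf) : Submodule ℂ (L2 × L2) where
  carrier := {w | ∃ v : L2, (w.1, v) ∈ H10 ∧ IsWeakDeriv (coeffMul γ v) (coeffMul γ₀ w.1 - w.2 : L2)}
  add_mem' := by
    rintro ⟨u, f⟩ ⟨u', f'⟩ ⟨v, hv, h⟩ ⟨v', hv', h'⟩
    refine ⟨v + v', H10.add_mem hv hv', ?_⟩
    have := h.add h'
    rw [← coeffMul_add, sub_add_sub_comm, ← coeffMul_add] at this
    exact this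
  zero_mem' := by
    refine ⟨0, H10.zero_mem, ?_⟩
    simp only [Prod.fst_zero, Prod.snd_zero, coeffMul_zero, sub_zero]
    exact isWeakDeriv_zero
  smul_mem' := by
    rintro c ⟨u, f⟩ ⟨v, hv, h⟩
    refine ⟨c • v, H10.smul_mem c hv, ?_⟩
    have := h.smul c
    rw [← coeffMul_smul, smul_sub, ← coeffMul_smul] at this
    exact this

theorem scalarGraph_functional (γ γ₀ : LInf) :
    ∀ w : L2 × L2, w ∈ scalarGraph γ γ₀ → w.1 = 0 → w.2 = 0 := by
  rintro ⟨u, f⟩ ⟨v, hv, h⟩ (rfl : u = 0)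
  obtain rfl : v = 0 := (isWeakDeriv_of_mem_H10 hv).eq_zero
  simp only [coeffMul_zero, zero_sub] at h
  exact neg_eq_zero.1 h.eq_zero

/-- The scalar operator `u ↦ -(γ u')' + γ₀ u` in `L²(0, π)`, with domain
`{u ∈ H¹₀(0, π) | -(γ u')' + γ₀ u ∈ L²(0, π)}`. -/
def scalarOp (γ γ₀ : LInf) : L2 →ₗ.[ℂ] L2 := (scalarGraph γ γ₀).toLinearPMap

theorem scalarOp_graph (γ γ₀ : LInf) : (scalarOp γ γ₀).graph = scalarGraph γ γ₀ :=
  Submodule.toLinearPMap_graph_eq _ (scalarGraph_functional γ γ₀)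

/-- The graph of the operator `(u₁, u₂) ↦ (L u₁ + q u₂ - (p u₂)', L u₂)`, where `L` is the scalar
operator, `u₁` and `u₂` are in the domain of `L`, and `(p u₂)'` is a weak derivative. -/
def adjointGraph (γ γ₀ p q : LInf) : Submodule ℂ (L2Pair × L2Pair) where
  carrier := {w | ∃ g₁ w₂ : L2, (w.1.fst, g₁) ∈ scalarGraph γ γ₀ ∧
    (w.1.snd, w.2.snd) ∈ scalarGraph γ γ₀ ∧ IsWeakDeriv (coeffMul p w.1.snd) w₂ ∧
    w.2.fst = g₁ + coeffMul q w.1.snd - w₂}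
  add_mem' := by
    rintro ⟨u, f⟩ ⟨u', f'⟩ ⟨g, d, h₁, h₂, h₃, h₄⟩ ⟨g', d', h₁', h₂', h₃', h₄'⟩
    refine ⟨g + g', d + d', add_mem h₁ h₁', add_mem h₂ h₂', ?_, ?_⟩
    · have := h₃.add h₃'
      rw [← coeffMul_add] at this
      exact this
    · change f.fst + f'.fst = _ + coeffMul q (u.snd + u'.snd) - _
      change f.fst = g + coeffMul q u.snd - d at h₄
      change f'.fst = g' + coeffMul q u'.snd - d' at h₄'
      rw [h₄, h₄', coeffMul_add]
      abel
  zero_mem' := by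
    refine ⟨0, 0, Submodule.zero_mem _, Submodule.zero_mem _, ?_, ?_⟩
    · change IsWeakDeriv (coeffMul p 0) _
      rw [coeffMul_zero]
      exact isWeakDeriv_zero
    · change (0 : L2) = 0 + coeffMul q 0 - 0
      rw [coeffMul_zero]
      simp
  smul_mem' := by
    rintro c ⟨u, f⟩ ⟨g, d, h₁, h₂, h₃, h₄⟩
    refine ⟨c • g, c • d, Submodule.smul_mem _ c h₁, Submodule.smul_mem _ c h₂, ?_, ?_⟩
    · have := h₃.smul c
      rw [← coeffMul_smul] at this
      exact this
    · change c • f.fst = _ + coeffMul q (c • u.snd) - _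
      change f.fst = g + coeffMul q u.snd - d at h₄
      rw [h₄, coeffMul_smul, smul_sub, smul_add]

theorem adjointGraph_functional (γ γ₀ p q : LInf) :
    ∀ w : L2Pair × L2Pair, w ∈ adjointGraph γ γ₀ p q → w.1 = 0 → w.2 = 0 := by
  rintro ⟨u, f⟩ ⟨g, d, h₁, h₂, h₃, h₄⟩ (rfl : u = 0)
  have e₁ : g = 0 := scalarGraph_functional γ γ₀ (0, g) h₁ rfl
  have e₂ : f.snd = 0 := scalarGraph_functional γ γ₀ (0, f.snd) h₂ rfl
  have e₃ : d = 0 := by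
    change IsWeakDeriv (coeffMul p 0) d at h₃
    rw [coeffMul_zero] at h₃
    exact h₃.eq_zero
  have e₄ : f.fst = 0 := by
    change f.fst = g + coeffMul q 0 - d at h₄
    rw [h₄, e₁, e₃, coeffMul_zero]
    simp
  exact WithLp.ofLp_injective 2 (Prod.ext e₄ e₂)

/-- The operator `(u₁, u₂) ↦ (L u₁ + q u₂ - (p u₂)', L u₂)` in `L²(0, π)²`. -/
def adjointOp (γ γ₀ p q : LInf) : L2Pair →ₗ.[ℂ] L2Pair := (adjointGraph γ γ₀ p q).toLinearPMap

theorem adjointOp_graph (γ γ₀ p q : LInf) :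
    (adjointOp γ γ₀ p q).graph = adjointGraph γ γ₀ p q :=
  Submodule.toLinearPMap_graph_eq _ (adjointGraph_functional γ γ₀ p q)

/-! ### Eigenfunctions -/

/-- `φ` is a real eigenfunction of the scalar operator for `z`, normalized in `L²(0, π)`. -/
def IsNormalizedEigenfunction (γ γ₀ : LInf) (z : ℂ) (φ : L2R) : Prop :=
  UnboundedOp.IsEigenvector (scalarOp γ γ₀) z (toComplex φ) ∧ ‖φ‖ = 1

/-- The number `∫ (q - p' / 2) φ²` over `(0, π)`; `dp` stands for `p'`. -/
def couplingIntegral (dp q : LInf) (φ : L2R) : ℝ := ∫ x, (q x - dp x / 2) * φ x ^ 2 ∂μ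

/-- `ψ` is in the domain of the scalar operator `L`, solves
`L ψ - z ψ = (p φ)' - q φ + (∫ (q - p' / 2) φ²) φ`, and is orthogonal to `φ` in `L²(ω)`. -/
def IsPsi (γ γ₀ p dp q : LInf) (ω : Set ℝ) (z : ℂ) (φ : L2R) (ψ : L2) : Prop :=
  (∃ (hψ : ψ ∈ (scalarOp γ γ₀).domain) (d : L2), IsWeakDeriv (coeffMul p (toComplex φ)) d ∧
    scalarOp γ γ₀ ⟨ψ, hψ⟩ - z • ψ =
      d - coeffMul q (toComplex φ) + (couplingIntegral dp q φ : ℂ) • toComplex φ) ∧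
  ∫ x in ω, (φ x : ℂ) * ψ x = 0

/-- The element `(u₁, u₂)` of `L²(0, π)²`. -/
def pair (u₁ u₂ : L2) : L2Pair := WithLp.toLp 2 (u₁, u₂)

end Cascade

end

/-! The equation `(L - z) u = f` is read as the first order system `U' = W / γ`, `W' = (γ₀ - z) U -
f` with `W = γ U'` absolutely continuous, so that no regularity of `γ` is needed (`mem_H10_iff`,
`mem_scalarGraph_iff`). Let `(y₁, w₁)` be the homogeneous solution with data `(0, 1)` at `0`; with
the solution with data `(1, 0)` it has Wronskian one. Then `z` is an eigenvalue of `L` if and only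
if `y₁ π = 0`, and the eigenspace is then the line through `y₁`. If `y₁ π ≠ 0`, variation of
parameters gives a bounded resolvent (`exists_resolvent`). If `y₁ π = 0`, the Lagrange identity
gives the Fredholm alternative: `(L - z) u = f` is solvable if and only if `∫ y₁ f = 0`.

The coupled operator is upper triangular with `L` twice on the diagonal, so back substitution
inverts it off the eigenvalues of `L`, and at an eigenvalue of `L` the pair `(φ, 0)` is an
eigenvector. An element of the kernel there has second component `c φ`, and its first component must
solve `(L - z) u₁ = c ((p φ)' - q φ)`. Because `p φ²` vanishes at both ends, `∫ φ ((p φ)' - q φ) =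
-I` (`integral_coupling`), so the solvability condition is `c I = 0`. If `I ≠ 0` the kernel is the
line of `(φ, 0)`; if `I = 0` it is the plane spanned by `(φ, 0)` and `(ψ, φ)`. The term `I φ` in the
equation for `ψ` cancels the obstruction in all cases and reappears as `(A - z) Ψ = I Φ`. The
remaining freedom `ψ + c φ` is removed by the condition on `ω`, since `φ` does not vanish almost
everywhere on an open set. -/

namespace Cascade

/-! ### Primitives of integrable functions on `(0, π)` -/

/-- The primitive `x ↦ ∫ g` over `(0, π) ∩ (-∞, x]`. -/
noncomputable def primitive (g : ℝ → ℂ) (x : ℝ) : ℂ := ∫ t in Iic x, g t ∂μ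

/-- `f` is a primitive of the integrable function `g` on `(0, π)`; it is constant on `(-∞, 0]` and
on `[π, ∞)`. -/
structure IsPrimitive (f g : ℝ → ℂ) : Prop where
  integrable : Integrable g μ
  eq_add : ∀ x, f x = f 0 + primitive g x

theorem primitive_of_nonpos (g : ℝ → ℂ) {x : ℝ} (hx : x ≤ 0) : primitive g x = 0 := by
  have : (μ.restrict (Iic x)) = 0 := by
    rw [Measure.restrict_restrict measurableSet_Iic, Measure.restrict_eq_zero]
    convert measure_empty (μ := (volume : Measure ℝ))
    ext t
    simp only [mem_inter_iff, mem_Iic, mem_Ioo, mem_empty_iff_false, iff_false]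
    rintro ⟨h₁, h₂, -⟩
    linarith
  rw [primitive, this, integral_zero_measure]

theorem primitive_zero (g : ℝ → ℂ) : primitive g 0 = 0 := primitive_of_nonpos g le_rfl

theorem primitive_pi (g : ℝ → ℂ) : primitive g Real.pi = ∫ x, g x ∂μ := by
  rw [primitive, Measure.restrict_restrict measurableSet_Iic,
    inter_eq_right.2 (fun x hx => hx.2.le)]

theorem primitive_congr {g h : ℝ → ℂ} (e : g =ᵐ[μ] h) : primitive g = primitive h := by
  funext x
  exact integral_congr_ae (ae_restrict_of_ae e)

theorem norm_primitive_le {g : ℝ → ℂ} (hg : Integrable g μ) (x : ℝ) :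
    ‖primitive g x‖ ≤ ∫ t, ‖g t‖ ∂μ :=
  (norm_integral_le_integral_norm _).trans
    (setIntegral_le_integral hg.norm (Filter.Eventually.of_forall fun _ => norm_nonneg _))

theorem continuous_primitive {g : ℝ → ℂ} (hg : Integrable g μ) : Continuous (primitive g) := by
  have e : primitive g = fun x => primitive g 0 + ∫ t in (0 : ℝ)..x, g t ∂μ := by
    funext x
    rw [← intervalIntegral.integral_Iic_sub_Iic hg.integrableOn hg.integrableOn]
    simp [primitive]
  rw [e]
  exact continuous_const.add
    (intervalIntegral.continuous_primitive (fun a b => hg.intervalIntegrable) 0)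

theorem primitive_add {g h : ℝ → ℂ} (hg : Integrable g μ) (hh : Integrable h μ) (x : ℝ) :
    primitive (fun t => g t + h t) x = primitive g x + primitive h x :=
  integral_add hg.integrableOn hh.integrableOn

theorem primitive_sub {g h : ℝ → ℂ} (hg : Integrable g μ) (hh : Integrable h μ) (x : ℝ) :
    primitive (fun t => g t - h t) x = primitive g x - primitive h x :=
  integral_sub hg.integrableOn hh.integrableOn

theorem primitive_const_mul (c : ℂ) (g : ℝ → ℂ) (x : ℝ) :
    primitive (fun t => c * g t) x = c * primitive g x :=
  integral_const_mul c g

theorem primitive_conj (g : ℝ → ℂ) (x : ℝ) :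
    primitive (fun t => (starRingEnd ℂ) (g t)) x = (starRingEnd ℂ) (primitive g x) :=
  integral_conj

theorem isPrimitive_primitive {g : ℝ → ℂ} (hg : Integrable g μ) : IsPrimitive (primitive g) g :=
  ⟨hg, fun x => by rw [primitive_zero, zero_add]⟩

theorem isPrimitive_const (c : ℂ) : IsPrimitive (fun _ => c) (fun _ => 0) :=
  ⟨integrable_zero _ _ _, fun x => by simp [primitive]⟩

namespace IsPrimitive

variable {f g h k : ℝ → ℂ}

theorem continuous (H : IsPrimitive f g) : Continuous f := by
  rw [funext H.eq_add]
  exact continuous_const.add (continuous_primitive H.integrable)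

theorem exists_bound (H : IsPrimitive f g) : ∃ C, ∀ x, ‖f x‖ ≤ C := by
  refine ⟨‖f 0‖ + ∫ t, ‖g t‖ ∂μ, fun x => ?_⟩
  rw [H.eq_add x]
  exact (norm_add_le _ _).trans (add_le_add_right (norm_primitive_le H.integrable x) _)

theorem memLp (H : IsPrimitive f g) (p : ℝ≥0∞) : MemLp f p μ := by
  obtain ⟨C, hC⟩ := H.exists_bound
  exact MemLp.of_bound H.continuous.aestronglyMeasurable C (Filter.Eventually.of_forall hC)

theorem integrable_self (H : IsPrimitive f g) : Integrable f μ :=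
  memLp_one_iff_integrable.1 (H.memLp 1)

theorem integrable_mul (H : IsPrimitive f g) (hk : Integrable k μ) :
    Integrable (fun x => f x * k x) μ := by
  obtain ⟨C, hC⟩ := H.exists_bound
  exact hk.bdd_mul H.continuous.aestronglyMeasurable (Filter.Eventually.of_forall hC)

theorem congr (H : IsPrimitive f g) (e : g =ᵐ[μ] h) : IsPrimitive f h :=
  ⟨H.integrable.congr e, fun x => by rw [H.eq_add x, primitive_congr e]⟩

theorem add (H : IsPrimitive f g) (K : IsPrimitive h k) :
    IsPrimitive (fun x => f x + h x) (fun x => g x + k x) :=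
  ⟨H.integrable.add K.integrable, fun x => by
    rw [primitive_add H.integrable K.integrable, H.eq_add x, K.eq_add x]; ring⟩

theorem sub (H : IsPrimitive f g) (K : IsPrimitive h k) :
    IsPrimitive (fun x => f x - h x) (fun x => g x - k x) :=
  ⟨H.integrable.sub K.integrable, fun x => by
    rw [primitive_sub H.integrable K.integrable, H.eq_add x, K.eq_add x]; ring⟩

theorem const_mul (c : ℂ) (H : IsPrimitive f g) :
    IsPrimitive (fun x => c * f x) (fun x => c * g x) :=
  ⟨H.integrable.const_mul c, fun x => by rw [primitive_const_mul, H.eq_add x]; ring⟩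

theorem conj (H : IsPrimitive f g) :
    IsPrimitive (fun x => (starRingEnd ℂ) (f x)) (fun x => (starRingEnd ℂ) (g x)) := by
  refine ⟨?_, fun x => by rw [primitive_conj, H.eq_add x, map_add]⟩
  exact (integrable_norm_iff (Complex.continuous_conj.comp_aestronglyMeasurable
    H.integrable.aestronglyMeasurable)).1 (by simpa using H.integrable.norm)

theorem integral_eq (H : IsPrimitive f g) : ∫ x, g x ∂μ = f Real.pi - f 0 := by
  rw [H.eq_add Real.pi, primitive_pi]; ring

end IsPrimitive

/-- Fubini on the square `(-∞, x]²`: the product is the double integral of `g s * k t`, and the two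
halves cut out by the diagonal give the two terms. -/
theorem primitive_mul_primitive {g k : ℝ → ℂ} (hg : Integrable g μ) (hk : Integrable k μ) (x : ℝ) :
    primitive g x * primitive k x
      = primitive (fun t => g t * primitive k t + primitive g t * k t) x := by
  set ν : Measure ℝ := μ.restrict (Iic x) with hν
  have hgν : Integrable g ν := hg.integrableOn
  have hkν : Integrable k ν := hk.integrableOn
  have hgk := hgν.mul_prod hkν
  set S : Set (ℝ × ℝ) := {z | z.1 ≤ z.2} with hS
  have mS : MeasurableSet S := measurableSet_le measurable_fst measurable_snd
  have hν_le : ∀ᵐ t ∂ν, t ≤ x := ae_restrict_mem measurableSet_Iic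
  have e₁ : ∫ z in S, g z.1 * k z.2 ∂ν.prod ν = ∫ t, primitive g t * k t ∂ν := by
    rw [← integral_indicator mS, integral_prod_symm _ (hgk.indicator mS)]
    refine integral_congr_ae ?_
    filter_upwards [hν_le] with t ht
    have : ∀ s, S.indicator (fun z : ℝ × ℝ => g z.1 * k z.2) (s, t)
        = (Iic t).indicator g s * k t := by
      intro s
      by_cases h : s ≤ t <;> simp [S, indicator, h]
    simp_rw [this]
    rw [integral_mul_const, integral_indicator measurableSet_Iic, hν,
      Measure.restrict_restrict measurableSet_Iic, Iic_inter_Iic, inf_eq_left.2 ht]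
    rfl
  -- Above the diagonal the inner integral runs over the open half-line `Iio s`; as Lebesgue measure
  -- has no atoms, it equals the primitive over `Iic s`.
  have e₂ : ∫ z in Sᶜ, g z.1 * k z.2 ∂ν.prod ν = ∫ t, g t * primitive k t ∂ν := by
    rw [← integral_indicator mS.compl, integral_prod _ (hgk.indicator mS.compl)]
    refine integral_congr_ae ?_
    filter_upwards [hν_le] with s hs
    have : ∀ t, Sᶜ.indicator (fun z : ℝ × ℝ => g z.1 * k z.2) (s, t)
        = g s * (Iio s).indicator k t := by
      intro t
      by_cases h : s ≤ t <;> simp [S, indicator, h]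
    simp_rw [this]
    rw [integral_const_mul, integral_indicator measurableSet_Iio, hν,
      Measure.restrict_restrict measurableSet_Iio,
      inter_eq_left.2 (Iio_subset_Iic_self.trans (Iic_subset_Iic.2 hs)),
      setIntegral_congr_set (Iio_ae_eq_Iic (μ := μ))]
    rfl
  have i₁ : Integrable (fun t => g t * primitive k t) μ := by
    simp_rw [mul_comm (g _)]
    exact (isPrimitive_primitive hk).integrable_mul hg
  have i₂ := (isPrimitive_primitive hg).integrable_mul hk
  rw [primitive_add i₁ i₂]
  calc primitive g x * primitive k x = ∫ z, g z.1 * k z.2 ∂ν.prod ν := (integral_prod_mul g k).symm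
    _ = _ := by
      rw [← integral_add_compl mS hgk, e₁, e₂, add_comm]
      rfl

/-- The product rule for primitives. -/
theorem IsPrimitive.mul {f g h k : ℝ → ℂ} (H : IsPrimitive f g) (K : IsPrimitive h k) :
    IsPrimitive (fun x => f x * h x) (fun x => g x * h x + f x * k x) := by
  have i₁ : Integrable (fun x => g x * h x) μ := by
    simp_rw [mul_comm (g _)]
    exact K.integrable_mul H.integrable
  have i₂ := H.integrable_mul K.integrable
  refine ⟨i₁.add i₂, fun x => ?_⟩
  have j₁ : Integrable (fun t => h 0 * g t) μ := H.integrable.const_mul _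
  have j₂ : Integrable (fun t => f 0 * k t) μ := K.integrable.const_mul _
  have j₃ : Integrable (fun t => g t * primitive k t) μ := by
    simp_rw [mul_comm (g _)]
    exact (isPrimitive_primitive K.integrable).integrable_mul H.integrable
  have j₄ := (isPrimitive_primitive H.integrable).integrable_mul K.integrable
  -- With each function split into its value at `0` and a primitive, only the product of the two
  -- primitives is not linear.
  have e : (fun t => g t * h t + f t * k t) = fun t => (h 0 * g t + f 0 * k t)
      + (g t * primitive k t + primitive g t * k t) := by
    funext t
    rw [H.eq_add t, K.eq_add t]; ring
  have e' : primitive (fun t => g t * h t + f t * k t) x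
      = h 0 * primitive g x + f 0 * primitive k x + primitive g x * primitive k x := by
    rw [e, primitive_mul_primitive H.integrable K.integrable, ← primitive_const_mul,
      ← primitive_const_mul, ← primitive_add j₁ j₂]
    exact primitive_add (j₁.add j₂) (j₃.add j₄) x
  rw [e', H.eq_add x, K.eq_add x]
  ring

/-! ### Primitives and weak derivatives -/

theorem integrable_of_L2 (u : L2) : Integrable u μ := (Lp.memLp u).integrable one_le_two

theorem isPrimitive_testFunction {θ : ℝ → ℂ} (h₁ : ContDiff ℝ (⊤ : ℕ∞) θ) (h₂ : HasCompactSupport θ)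
    (h₃ : tsupport θ ⊆ Ioo 0 Real.pi) : IsPrimitive θ (deriv θ) := by
  have hd : Continuous (deriv θ) := h₁.continuous_deriv (by simp)
  have h0 : θ 0 = 0 := image_eq_zero_of_notMem_tsupport fun h => lt_irrefl _ (h₃ h).1
  refine ⟨(hd.integrable_of_hasCompactSupport h₂.deriv).integrableOn, fun x => ?_⟩
  rw [h0, zero_add, primitive, Measure.restrict_restrict measurableSet_Iic,
    ← HasCompactSupport.integral_Iic_deriv_eq (h₁.of_le (by simp)) h₂ x, inter_comm,
    ← Measure.restrict_restrict measurableSet_Ioo]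
  refine (setIntegral_eq_integral_of_forall_compl_eq_zero fun t ht => ?_).symm
  exact image_eq_zero_of_notMem_tsupport fun h => ht (h₃ (tsupport_deriv_subset h))

theorem ofReal_testFunction (θ : 𝓓(Ω, ℝ)) :
    IsPrimitive (fun x => (θ x : ℂ)) (fun x => ((deriv θ x : ℝ) : ℂ)) := by
  have e : deriv (fun x => (θ x : ℂ)) = fun x => ((deriv θ x : ℝ) : ℂ) := by
    funext x
    exact (differentiable_testFunction θ x).hasDerivAt.ofReal_comp.deriv
  rw [← e]
  have hs : tsupport (fun x => (θ x : ℂ)) ⊆ tsupport θ :=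
    closure_mono (Function.support_comp_subset (g := Complex.ofReal) Complex.ofReal_zero θ)
  exact isPrimitive_testFunction (Complex.ofRealCLM.contDiff.comp θ.contDiff)
    (θ.hasCompactSupport.comp_left Complex.ofReal_zero) (hs.trans θ.tsupport_subset)

theorem testFunction_zero {F : Type*} [NormedAddCommGroup F] [NormedSpace ℝ F] (θ : 𝓓(Ω, F)) :
    θ 0 = 0 :=
  image_eq_zero_of_notMem_tsupport fun h => lt_irrefl _ (θ.tsupport_subset h).1

theorem testFunction_pi {F : Type*} [NormedAddCommGroup F] [NormedSpace ℝ F] (θ : 𝓓(Ω, F)) :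
    θ Real.pi = 0 :=
  image_eq_zero_of_notMem_tsupport fun h => lt_irrefl _ (θ.tsupport_subset h).2

/-- The product rule for `θ f` has no boundary terms, because a test function vanishes at `0` and
`π`. -/
theorem IsPrimitive.isWeakDeriv {f g : ℝ → ℂ} (H : IsPrimitive f g) : IsWeakDeriv f g := by
  intro θ
  have K := ofReal_testFunction θ
  have e := (K.mul H).integral_eq
  have i₁ : Integrable (fun x => ((deriv θ x : ℝ) : ℂ) * f x) μ := by
    simp_rw [mul_comm _ (f _)]
    exact H.integrable_mul K.integrable
  rw [integral_add i₁ (K.integrable_mul H.integrable), testFunction_zero, testFunction_pi] at e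
  simp only [Complex.real_smul]
  rw [eq_neg_iff_add_eq_zero, e]
  simp

theorem IsWeakDeriv.congr {F : Type*} [NormedAddCommGroup F] [NormedSpace ℝ F]
    {f g f' g' : ℝ → F} (h : IsWeakDeriv f g) (hf : f =ᵐ[μ] f') (hg : g =ᵐ[μ] g') :
    IsWeakDeriv f' g' := by
  intro θ
  have e₁ : ∫ x, deriv θ x • f' x ∂μ = ∫ x, deriv θ x • f x ∂μ :=
    integral_congr_ae (hf.mono fun x hx => by simp only [hx])
  have e₂ : ∫ x, θ x • g' x ∂μ = ∫ x, θ x • g x ∂μ :=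
    integral_congr_ae (hg.mono fun x hx => by simp only [hx])
  rw [e₁, e₂, h θ]

theorem exists_Icc_of_isCompact {K : Set ℝ} (hK : IsCompact K) (hs : K ⊆ Ioo 0 Real.pi) :
    ∃ a b, 0 < a ∧ b < Real.pi ∧ K ⊆ Icc a b := by
  rcases K.eq_empty_or_nonempty with rfl | hne
  -- For empty `K` any admissible endpoints serve.
  · exact ⟨1, 0, one_pos, Real.pi_pos, empty_subset _⟩
  · exact ⟨sInf K, sSup K, (hs (hK.sInf_mem hne)).1, (hs (hK.sSup_mem hne)).2,
      fun x hx => ⟨csInf_le hK.bddBelow hx, le_csSup hK.bddAbove hx⟩⟩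

/-- A test function with integral zero is the derivative of a test function. -/
theorem exists_deriv_eq {η : ℝ → ℝ} (h₁ : ContDiff ℝ (⊤ : ℕ∞) η) (h₂ : HasCompactSupport η)
    (h₃ : tsupport η ⊆ Ioo 0 Real.pi) (h₄ : ∫ x, η x = 0) : ∃ θ : 𝓓(Ω, ℝ), deriv θ = η := by
  obtain ⟨a, b, ha, hb, hab⟩ := exists_Icc_of_isCompact h₂ h₃
  have hi : Integrable η := h₁.continuous.integrable_of_hasCompactSupport h₂
  set θ : ℝ → ℝ := fun x => ∫ t in (0 : ℝ)..x, η t with hθ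
  have hd : ∀ x, HasDerivAt θ (η x) x := fun x =>
    intervalIntegral.integral_hasDerivAt_right hi.intervalIntegrable
      (h₁.continuous.stronglyMeasurableAtFilter _ _) h₁.continuous.continuousAt
  have hde : deriv θ = η := funext fun x => (hd x).deriv
  have hη : ∀ x, x ∉ Icc a b → η x = 0 := fun x hx =>
    image_eq_zero_of_notMem_tsupport fun h => hx (hab h)
  -- The base point `0` may be moved to `-∞`, since `η` vanishes on `(-∞, 0]`.
  have hI : ∀ x, ∫ t in Iic x, η t = θ x := by
    intro x
    rw [hθ]
    simp only
    rw [← intervalIntegral.integral_Iic_sub_Iic hi.integrableOn hi.integrableOn, eq_comm,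
      sub_eq_self]
    refine setIntegral_eq_zero_of_forall_eq_zero fun t (ht : t ≤ 0) => hη t fun h => ?_
    linarith [h.1]
  have hsupp : Function.support θ ⊆ Icc a b := by
    intro x hx
    by_contra hx'
    refine hx ?_
    rw [← hI]
    rw [mem_Icc, not_and_or, not_le, not_le] at hx'
    rcases hx' with hx' | hx'
    · refine setIntegral_eq_zero_of_forall_eq_zero fun t (ht : t ≤ x) => hη t fun h => ?_
      linarith [h.1]
    -- To the right of `b` the primitive is the full integral of `η`; this is where mean zero is
    -- used.
    · rw [← h₄]
      refine setIntegral_eq_integral_of_forall_compl_eq_zero fun t ht => hη t fun h => ht ?_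
      exact h.2.trans hx'.le
  have hts : tsupport θ ⊆ Icc a b := closure_minimal hsupp isClosed_Icc
  refine ⟨⟨θ, ?_, HasCompactSupport.of_support_subset_isCompact isCompact_Icc hsupp,
    hts.trans fun x hx => ⟨ha.trans_le hx.1, hx.2.trans_lt hb⟩⟩, hde⟩
  refine contDiff_infty_iff_deriv.2 ⟨fun x => (hd x).differentiableAt, ?_⟩
  rw [hde]
  exact h₁

theorem exists_testFunction_integral_eq_one : ∃ ρ : 𝓓(Ω, ℝ), ∫ x, ρ x = 1 := by
  have hpi := Real.pi_pos
  -- Radius one about `π / 2` stays inside the interval because `π > 3`.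
  let b : ContDiffBump (Real.pi / 2) := ⟨1 / 2, 1, by norm_num, by norm_num⟩
  refine ⟨⟨b.normed volume, b.contDiff_normed, b.hasCompactSupport_normed, ?_⟩,
    b.integral_normed⟩
  rw [b.tsupport_normed_eq, Real.closedBall_eq_Icc]
  intro x hx
  have h1 : b.rOut = 1 := rfl
  rw [h1] at hx
  exact ⟨by linarith [hx.1, Real.pi_gt_three], by linarith [hx.2, Real.pi_gt_three]⟩

theorem setIntegral_testFunction_smul {F : Type*} [NormedAddCommGroup F] [NormedSpace ℝ F]
    {η : ℝ → ℝ} (h : tsupport η ⊆ Ioo 0 Real.pi) (g : ℝ → F) :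
    ∫ x, η x • g x ∂μ = ∫ x, η x • g x :=
  setIntegral_eq_integral_of_forall_compl_eq_zero fun x hx => by
    rw [image_eq_zero_of_notMem_tsupport (fun hx' => hx (h hx')), zero_smul]

/-- The du Bois-Reymond lemma. -/
theorem ae_eq_const_of_integral_deriv_smul_eq_zero {g : ℝ → ℂ} (hg : Integrable g μ)
    (h : ∀ θ : 𝓓(Ω, ℝ), ∫ x, deriv θ x • g x ∂μ = 0) : ∃ c : ℂ, g =ᵐ[μ] fun _ => c := by
  obtain ⟨ρ, hρ⟩ := exists_testFunction_integral_eq_one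
  have hint : ∀ {η : ℝ → ℝ} {f : ℝ → ℂ}, Continuous η → HasCompactSupport η → Integrable f μ →
      Integrable (fun x => η x • f x) μ := by
    intro η f hc hs hf
    obtain ⟨C, hC⟩ := hc.bounded_above_of_compact_support hs
    exact hf.bdd_smul C hc.aestronglyMeasurable (Filter.Eventually.of_forall hC)
  set c : ℂ := ∫ x, ρ x • g x ∂μ with hc
  refine ⟨c, ?_⟩
  have hgc : Integrable (fun x => g x - c) μ := hg.sub (integrable_const c)
  have key := isOpen_Ioo.ae_eq_zero_of_integral_contDiff_smul_eq_zero (μ := volume)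
    (U := Ioo 0 Real.pi) (f := fun x => g x - c) (IntegrableOn.locallyIntegrableOn hgc) (by
      intro η h₁ h₂ h₃
      rw [← setIntegral_testFunction_smul h₃]
      have hi : Integrable η := h₁.continuous.integrable_of_hasCompactSupport h₂
      have hiρ : Integrable ρ := (map_continuous ρ).integrable_of_hasCompactSupport
        ρ.hasCompactSupport
      set m : ℝ := ∫ x, η x with hm
      -- Subtracting `m ρ` gives `η` mean zero, hence makes it a derivative. Testing `g` against it
      -- yields `∫ η g = m c`, which is `∫ η c`.
      have hc₁ : ContDiff ℝ (⊤ : ℕ∞) (fun x => η x - m * ρ x) := h₁.sub (contDiff_const.mul ρ.contDiff)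
      have hsub : Function.support (fun x => η x - m * ρ x) ⊆ tsupport η ∪ tsupport ρ := by
        intro x hx
        by_contra hx'
        rw [mem_union, not_or] at hx'
        refine hx ?_
        simp [image_eq_zero_of_notMem_tsupport hx'.1, image_eq_zero_of_notMem_tsupport hx'.2]
      have hK : IsCompact (tsupport η ∪ tsupport ρ) := h₂.isCompact.union ρ.hasCompactSupport
      obtain ⟨θ, hθ⟩ := exists_deriv_eq hc₁ (HasCompactSupport.of_support_subset_isCompact hK hsub)
        ((closure_minimal hsub hK.isClosed).trans (union_subset h₃ ρ.tsupport_subset)) (by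
          rw [integral_sub hi (hiρ.const_mul m), integral_const_mul, hρ, mul_one, sub_self])
      have e := h θ
      rw [hθ] at e
      have i₁ := hint h₁.continuous h₂ hg
      have i₂ := hint (map_continuous ρ) ρ.hasCompactSupport hg
      have i₃ := hint h₁.continuous h₂ (integrable_const c)
      have e₁ : ∫ x, (η x - m * ρ x) • g x ∂μ = ∫ x, η x • g x ∂μ - (m : ℂ) * c := by
        rw [hc, ← integral_const_mul, ← integral_sub i₁ (i₂.const_mul _)]
        refine integral_congr_ae (Filter.Eventually.of_forall fun x => ?_)
        simp only [Complex.real_smul]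
        push_cast
        ring
      have e₂ : ∫ x, η x • c ∂μ = (m : ℂ) * c := by
        rw [setIntegral_testFunction_smul h₃, integral_smul_const, Complex.real_smul]
      simp_rw [smul_sub]
      rw [integral_sub i₁ i₃, e₂, ← e₁, e])
  refine (ae_restrict_iff' measurableSet_Ioo).2 (key.mono fun x hx hx' => ?_)
  exact sub_eq_zero.1 (hx hx')

/-- A function with an integrable weak derivative is a primitive of it. -/
theorem IsWeakDeriv.exists_isPrimitive {u v : ℝ → ℂ} (hu : Integrable u μ) (hv : Integrable v μ)
    (h : IsWeakDeriv u v) : ∃ f, IsPrimitive f v ∧ u =ᵐ[μ] f := by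
  have H := isPrimitive_primitive hv
  -- The difference of `u` and the primitive of `v` has weak derivative zero.
  obtain ⟨c, hc⟩ := ae_eq_const_of_integral_deriv_smul_eq_zero (hu.sub H.integrable_self) (by
    intro θ
    have hint : ∀ {f : ℝ → ℂ}, Integrable f μ → Integrable (fun x => deriv θ x • f x) μ := by
      intro f hf
      obtain ⟨C, hC⟩ := (continuous_deriv_testFunction θ).bounded_above_of_compact_support
        θ.hasCompactSupport.deriv
      exact hf.bdd_smul C (continuous_deriv_testFunction θ).aestronglyMeasurable
        (Filter.Eventually.of_forall hC)
    simp_rw [Pi.sub_apply, smul_sub]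
    rw [integral_sub (hint hu) (hint H.integrable_self), h θ, H.isWeakDeriv θ, sub_self])
  refine ⟨fun x => c + primitive v x, ⟨hv, fun x => by rw [primitive_zero, add_zero]⟩, ?_⟩
  filter_upwards [hc] with x hx
  rw [← hx]
  simp

theorem IsWeakDeriv.ofReal {f g : ℝ → ℝ} (h : IsWeakDeriv f g) :
    IsWeakDeriv (fun x => (f x : ℂ)) (fun x => (g x : ℂ)) := by
  intro θ
  have e := congrArg Complex.ofReal (h θ)
  simp only [smul_eq_mul, Complex.ofReal_neg, ← integral_complex_ofReal, Complex.ofReal_mul] at e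
  simpa only [Complex.real_smul] using e

/-- The function `(0, π) ∋ x ↦ x`, extended by constants. -/
theorem isPrimitive_id : IsPrimitive (primitive fun _ => 1) (fun _ => 1) :=
  isPrimitive_primitive (integrable_const _)

end Cascade

namespace Cascade

/-! ### Linear systems with bounded measurable coefficients -/

/-- `U' = a W` and `W' = b U - f` on `(0, π)`. -/
structure IsSolution (a b f U W : ℝ → ℂ) : Prop where
  fst : IsPrimitive U (fun x => a x * W x)
  snd : IsPrimitive W (fun x => b x * U x - f x)

/-- The nearest point of `[0, π]`. -/
noncomputable def clamp (x : ℝ) : ℝ := max 0 (min x Real.pi)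

theorem clamp_le_pi (x : ℝ) : clamp x ≤ Real.pi := max_le Real.pi_pos.le (min_le_right _ _)

theorem continuous_clamp : Continuous clamp := by unfold clamp; fun_prop

theorem integrable_exp_clamp (β : ℝ) : Integrable (fun t => Real.exp (β * clamp t)) μ := by
  refine memLp_one_iff_integrable.1 (MemLp.of_bound (by
    have := continuous_clamp
    exact (by fun_prop : Continuous fun t => Real.exp (β * clamp t)).aestronglyMeasurable)
    (Real.exp (|β| * Real.pi)) (Filter.Eventually.of_forall fun t => ?_))
  rw [Real.norm_eq_abs, Real.abs_exp]
  have h0 : 0 ≤ clamp t := le_max_left _ _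
  exact Real.exp_le_exp.2 ((mul_le_mul_of_nonneg_right (le_abs_self β) h0).trans
    (mul_le_mul_of_nonneg_left (clamp_le_pi t) (abs_nonneg β)))

/-- The exponential weight is chosen for the factor `1 / β` gained by integration. The bound follows
on enlarging the domain to the half-line up to `clamp x`. -/
theorem setIntegral_exp_clamp_le {β : ℝ} (hβ : 0 < β) (x : ℝ) :
    ∫ t in Iic x, Real.exp (β * clamp t) ∂μ ≤ Real.exp (β * clamp x) / β := by
  have hi : IntegrableOn (fun t => Real.exp (β * t)) (Iic (clamp x)) :=
    integrableOn_exp_mul_Iic hβ _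
  rw [← integral_exp_mul_Iic hβ, Measure.restrict_restrict measurableSet_Iic,
    setIntegral_congr_fun (g := fun t => Real.exp (β * t))
      (measurableSet_Iic.inter measurableSet_Ioo)]
  · refine setIntegral_mono_set hi (Filter.Eventually.of_forall fun t => (Real.exp_pos _).le) ?_
    refine Filter.Eventually.of_forall fun t ht => ?_
    exact (le_min ht.1 ht.2.2.le).trans (le_max_right _ _)
  · intro t ht
    have : clamp t = t := by
      rw [clamp, min_eq_left ht.2.2.le, max_eq_right ht.2.1.le]
    simp only [this]

theorem norm_primitive_sub_le {g h : ℝ → ℂ} (hg : Integrable g μ) (hh : Integrable h μ)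
    {β D : ℝ} (hβ : 0 < β) (hD : 0 ≤ D)
    (H : ∀ᵐ t ∂μ, ‖g t - h t‖ ≤ D * Real.exp (β * clamp t)) (x : ℝ) :
    ‖primitive g x - primitive h x‖ ≤ D * (Real.exp (β * clamp x) / β) := by
  rw [← primitive_sub hg hh]
  refine (norm_integral_le_of_norm_le ((integrable_exp_clamp β).const_mul D).integrableOn
    (ae_restrict_of_ae H)).trans ?_
  rw [integral_const_mul]
  exact mul_le_mul_of_nonneg_left (setIntegral_exp_clamp_le hβ x) hD

theorem integrable_mul_of_bounded {a X : ℝ → ℂ} {C D : ℝ} (ha : AEStronglyMeasurable a μ)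
    (hC : ∀ᵐ x ∂μ, ‖a x‖ ≤ C) (hX : AEStronglyMeasurable X μ) (hD : ∀ x, ‖X x‖ ≤ D) :
    Integrable (fun x => a x * X x) μ :=
  (memLp_one_iff_integrable.1
    (MemLp.of_bound hX D (Filter.Eventually.of_forall hD))).bdd_mul ha hC

open scoped BoundedContinuousFunction in
-- Picard iteration for the integral equations, on bounded continuous functions on the line. Errors
-- are measured against an exponential weight, so that existence holds on all of `(0, π)` without a
-- smallness condition.
theorem exists_isSolution_zero {a b : ℝ → ℂ} {C : ℝ} (ha : AEStronglyMeasurable a μ)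
    (hb : AEStronglyMeasurable b μ) (hCa : ∀ᵐ x ∂μ, ‖a x‖ ≤ C) (hCb : ∀ᵐ x ∂μ, ‖b x‖ ≤ C)
    (s t : ℂ) : ∃ U W, IsSolution a b 0 U W ∧ U 0 = s ∧ W 0 = t := by
  -- The weight has exponent `2 C`, which must be positive.
  wlog hC : 0 < C generalizing C
  · exact this (C := max C 1) (hCa.mono fun x hx => hx.trans (le_max_left _ _))
      (hCb.mono fun x hx => hx.trans (le_max_left _ _)) (lt_max_of_lt_right one_pos)
  have i₁ : ∀ X : ℝ →ᵇ ℂ × ℂ, Integrable (fun x => a x * (X x).2) μ := fun X =>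
    integrable_mul_of_bounded ha hCa (by fun_prop)
      (fun x => (norm_snd_le (X x)).trans (X.norm_coe_le_norm x))
  have i₂ : ∀ X : ℝ →ᵇ ℂ × ℂ, Integrable (fun x => b x * (X x).1) μ := fun X =>
    integrable_mul_of_bounded hb hCb (by fun_prop)
      (fun x => (norm_fst_le (X x)).trans (X.norm_coe_le_norm x))
  let T : (ℝ →ᵇ ℂ × ℂ) → (ℝ →ᵇ ℂ × ℂ) := fun X =>
    BoundedContinuousFunction.ofNormedAddCommGroup
      (fun x => (s + primitive (fun x => a x * (X x).2) x, t + primitive (fun x => b x * (X x).1) x))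
      ((continuous_const.add (continuous_primitive (i₁ X))).prodMk
        (continuous_const.add (continuous_primitive (i₂ X))))
      (max (‖s‖ + ∫ x, ‖a x * (X x).2‖ ∂μ) (‖t‖ + ∫ x, ‖b x * (X x).1‖ ∂μ))
      (fun x => max_le_max
        ((norm_add_le _ _).trans (add_le_add_right (norm_primitive_le (i₁ X) x) _))
        ((norm_add_le _ _).trans (add_le_add_right (norm_primitive_le (i₂ X) x) _)))
  -- The coefficients cost a factor `C` and integration gains `1 / (2 C)`, so each application of
  -- `T` halves the weighted error.
  have step : ∀ (X Y : ℝ →ᵇ ℂ × ℂ) (D : ℝ), 0 ≤ D →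
      (∀ x, ‖X x - Y x‖ ≤ D * Real.exp (2 * C * clamp x)) →
      ∀ x, ‖T X x - T Y x‖ ≤ D / 2 * Real.exp (2 * C * clamp x) := by
    intro X Y D hD H x
    have e : D / 2 * Real.exp (2 * C * clamp x)
        = C * D * (Real.exp (2 * C * clamp x) / (2 * C)) := by
      field_simp
    rw [e]
    refine max_le ?_ ?_
    · change ‖(s + primitive (fun x => a x * (X x).2) x)
        - (s + primitive (fun x => a x * (Y x).2) x)‖ ≤ _
      rw [add_sub_add_left_eq_sub]
      refine norm_primitive_sub_le (i₁ X) (i₁ Y) (by positivity) (by positivity) ?_ x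
      filter_upwards [hCa] with y hy
      rw [← mul_sub, norm_mul, mul_assoc]
      exact mul_le_mul hy ((norm_snd_le (X y - Y y)).trans (H y)) (norm_nonneg _) hC.le
    · change ‖(t + primitive (fun x => b x * (X x).1) x)
        - (t + primitive (fun x => b x * (Y x).1) x)‖ ≤ _
      rw [add_sub_add_left_eq_sub]
      refine norm_primitive_sub_le (i₂ X) (i₂ Y) (by positivity) (by positivity) ?_ x
      filter_upwards [hCb] with y hy
      rw [← mul_sub, norm_mul, mul_assoc]
      exact mul_le_mul hy ((norm_fst_le (X y - Y y)).trans (H y)) (norm_nonneg _) hC.le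
  have iter : ∀ (n : ℕ) (X Y : ℝ →ᵇ ℂ × ℂ) (x : ℝ),
      ‖T^[n] X x - T^[n] Y x‖ ≤ dist X Y / 2 ^ n * Real.exp (2 * C * clamp x) := by
    intro n X Y
    induction n with
    | zero =>
      intro x
      have h0 : 0 ≤ clamp x := le_max_left _ _
      rw [pow_zero, div_one, ← dist_eq_norm]
      exact (BoundedContinuousFunction.dist_coe_le_dist x).trans
        (le_mul_of_one_le_right dist_nonneg (Real.one_le_exp (by positivity)))
    | succ n ih =>
      intro x
      rw [Function.iterate_succ_apply', Function.iterate_succ_apply', pow_succ, ← div_div]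
      exact step _ _ _ (by positivity) ih x
  -- The weight lies between `1` and `exp (2 C π)`; this `n` makes `T^[n]` a contraction with
  -- constant `1 / 2` in the unweighted norm.
  obtain ⟨n, hn⟩ := pow_unbounded_of_one_lt (2 * Real.exp (2 * C * Real.pi)) one_lt_two
  have hcontr : ContractingWith (1 / 2) T^[n] := by
    refine ⟨by rw [div_lt_one two_pos]; exact one_lt_two, LipschitzWith.of_dist_le_mul fun X Y => ?_⟩
    rw [BoundedContinuousFunction.dist_le (by positivity)]
    intro x
    rw [dist_eq_norm]
    refine (iter n X Y x).trans ?_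
    have h2 : (0 : ℝ) < 2 ^ n := by positivity
    have hexp : Real.exp (2 * C * clamp x) ≤ Real.exp (2 * C * Real.pi) :=
      Real.exp_le_exp.2 (mul_le_mul_of_nonneg_left (clamp_le_pi x) (by positivity))
    rw [div_mul_eq_mul_div, div_le_iff₀ h2]
    have hd : 0 ≤ dist X Y := dist_nonneg
    push_cast
    nlinarith [mul_le_mul_of_nonneg_left hexp hd, mul_le_mul_of_nonneg_left hn.le hd]
  set X := ContractingWith.fixedPoint T^[n] hcontr
  -- The unique fixed point of an iterate of `T` is also fixed by `T`.
  have hfix : T X = X := hcontr.isFixedPt_fixedPoint_iterate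
  have hval : ∀ x, X x = (s + primitive (fun x => a x * (X x).2) x,
      t + primitive (fun x => b x * (X x).1) x) := by
    intro x
    conv_lhs => rw [← hfix]
    rfl
  have hs : (X 0).1 = s := by rw [hval, primitive_zero, add_zero]
  have ht : (X 0).2 = t := by rw [hval]; simp only [primitive_zero, add_zero]
  refine ⟨fun x => (X x).1, fun x => (X x).2, ⟨⟨i₁ X, fun x => ?_⟩, ⟨?_, fun x => ?_⟩⟩, hs, ht⟩
  · rw [hs, hval x]
  · simpa using i₂ X
  · rw [ht, hval x]
    simp

namespace IsSolution

variable {a b f g U W Y Z : ℝ → ℂ}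

theorem const_mul (c : ℂ) (h : IsSolution a b f U W) :
    IsSolution a b (fun x => c * f x) (fun x => c * U x) (fun x => c * W x) := by
  refine ⟨(h.fst.const_mul c).congr ?_, (h.snd.const_mul c).congr ?_⟩ <;>
  exact Filter.Eventually.of_forall fun x => by ring

theorem congr (h : IsSolution a b f U W) (e : f =ᵐ[μ] g) : IsSolution a b g U W :=
  ⟨h.fst, h.snd.congr (e.mono fun x hx => by simp only [hx])⟩

/-- The Lagrange identity. -/
theorem lagrange (h : IsSolution a b f U W) (k : IsSolution a b g Y Z) :
    IsPrimitive (fun x => U x * Z x - W x * Y x) (fun x => f x * Y x - U x * g x) :=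
  ((h.fst.mul k.snd).sub (h.snd.mul k.fst)).congr
    (Filter.Eventually.of_forall fun x => by ring)

theorem wronskian_eq (h : IsSolution a b 0 U W) (k : IsSolution a b 0 Y Z) (x : ℝ) :
    U x * Z x - W x * Y x = U 0 * Z 0 - W 0 * Y 0 := by
  have e := (h.lagrange k).eq_add x
  have e' : primitive (fun x => (0 : ℝ → ℂ) x * Y x - U x * (0 : ℝ → ℂ) x) x = 0 := by
    simp [primitive]
  rw [e', add_zero] at e
  exact e

end IsSolution

/-- The fundamental system of solutions of `U' = a W`, `W' = b U`. -/
structure IsFundamental (a b y₁ w₁ y₂ w₂ : ℝ → ℂ) : Prop where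
  sol₁ : IsSolution a b 0 y₁ w₁
  sol₂ : IsSolution a b 0 y₂ w₂
  y₁_zero : y₁ 0 = 0
  w₁_zero : w₁ 0 = 1
  y₂_zero : y₂ 0 = 1
  w₂_zero : w₂ 0 = 0

namespace IsFundamental

variable {a b f U W y₁ w₁ y₂ w₂ : ℝ → ℂ}

theorem wronskian (F : IsFundamental a b y₁ w₁ y₂ w₂) (x : ℝ) :
    y₂ x * w₁ x - w₂ x * y₁ x = 1 := by
  rw [F.sol₂.wronskian_eq F.sol₁, F.y₁_zero, F.w₁_zero, F.y₂_zero]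
  ring

/-- Uniqueness without Gronwall: the constant Wronskians of `(U, W)` with the two fundamental
solutions form a linear system for `(U x, W x)` of determinant one, solved by Cramer's rule. -/
theorem eq_mul (F : IsFundamental a b y₁ w₁ y₂ w₂) (h : IsSolution a b 0 U W) (h0 : U 0 = 0)
    (x : ℝ) : U x = W 0 * y₁ x ∧ W x = W 0 * w₁ x := by
  have e₁ := h.wronskian_eq F.sol₁ x
  have e₂ := h.wronskian_eq F.sol₂ x
  have e := F.wronskian x
  rw [h0, F.w₁_zero, F.y₁_zero] at e₁
  rw [h0, F.y₂_zero, F.w₂_zero] at e₂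
  constructor
  · linear_combination (-U x) * e + y₂ x * e₁ - y₁ x * e₂
  · linear_combination (-W x) * e + w₂ x * e₁ - w₁ x * e₂

/-- The solution of the inhomogeneous system with `U 0 = 0`, `W 0 = α`, by variation of
parameters. -/
theorem isSolution_variation (F : IsFundamental a b y₁ w₁ y₂ w₂) (hf : Integrable f μ) (α : ℂ) :
    IsSolution a b f
      (fun x => (α - primitive (fun t => y₂ t * f t) x) * y₁ x
        + primitive (fun t => y₁ t * f t) x * y₂ x)
      (fun x => (α - primitive (fun t => y₂ t * f t) x) * w₁ x
        + primitive (fun t => y₁ t * f t) x * w₂ x) := by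
  have A := (isPrimitive_const α).sub (isPrimitive_primitive (F.sol₂.fst.integrable_mul hf))
  have B := isPrimitive_primitive (F.sol₁.fst.integrable_mul hf)
  refine ⟨((A.mul F.sol₁.fst).add (B.mul F.sol₂.fst)).congr ?_,
    ((A.mul F.sol₁.snd).add (B.mul F.sol₂.snd)).congr ?_⟩
  · exact Filter.Eventually.of_forall fun x => by ring
  · refine Filter.Eventually.of_forall fun x => ?_
    have e := F.wronskian x
    simp only [Pi.zero_apply]
    -- Differentiating the coefficients contributes `-f (y₂ w₁ - w₂ y₁)`, which is `-f`.
    linear_combination (-f x) * e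

end IsFundamental

end Cascade

namespace Cascade

/-! ### Operators on `L²(0, π)` -/

theorem exists_bound_LInf (a : LInf) : ∃ C : ℝ, ∀ᵐ x ∂μ, ‖a x‖ ≤ C := by
  refine ⟨(eLpNormEssSup a μ).toReal, ?_⟩
  have h : eLpNormEssSup a μ ≠ ∞ := by
    rw [← eLpNorm_exponent_top]
    exact (Lp.memLp a).eLpNorm_ne_top
  filter_upwards [enorm_ae_le_eLpNormEssSup a μ] with x hx
  rw [← toReal_enorm]
  exact ENNReal.toReal_mono h hx

theorem coeffMul_ae (a : LInf) (u : L2) : coeffMul a u =ᵐ[μ] fun x => (a x : ℂ) * u x := by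
  filter_upwards [Lp.coeFn_lpSMul (r := 2) a u] with x hx
  refine hx.trans ?_
  rw [Pi.smul_apply', Complex.real_smul]

theorem norm_coeffMul_le (a : LInf) (u : L2) : ‖coeffMul a u‖ ≤ ‖a‖ * ‖u‖ :=
  Lp.norm_smul_le (r := 2) a u

/-- Multiplication by `a ∈ L^∞(0, π)`, as a bounded operator. -/
noncomputable def coeffMulCLM (a : LInf) : L2 →L[ℂ] L2 :=
  LinearMap.mkContinuous
    { toFun := coeffMul a
      map_add' := coeffMul_add a
      map_smul' := fun c u => coeffMul_smul c a u } ‖a‖ (norm_coeffMul_le a)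

theorem integral_norm_le (f : L2) :
    ∫ x, ‖f x‖ ∂μ ≤ (μ univ ^ ((1 : ℝ) / 2)).toReal * ‖f‖ := by
  have h := eLpNorm_le_eLpNorm_mul_rpow_measure_univ (p := 1) (q := 2) (μ := μ) (f := f)
    one_le_two (Lp.aestronglyMeasurable f)
  have hμ : μ univ ^ ((1 : ℝ) / 2) ≠ ∞ :=
    ENNReal.rpow_ne_top_of_nonneg (by norm_num) (measure_ne_top _ _)
  rw [integral_norm_eq_lintegral_enorm (Lp.aestronglyMeasurable f), ← eLpNorm_one_eq_lintegral_enorm,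
    Lp.norm_def, ← ENNReal.toReal_mul]
  refine ENNReal.toReal_mono (ENNReal.mul_ne_top hμ (Lp.memLp f).eLpNorm_ne_top) (h.trans_eq ?_)
  rw [mul_comm]
  norm_num

/-- A linear map into bounded functions defines a bounded operator on `L²(0, π)`. -/
theorem exists_continuousLinearMap (T : L2 → ℝ → ℂ) (C : ℝ)
    (hadd : ∀ f g, T (f + g) =ᵐ[μ] fun x => T f x + T g x)
    (hsmul : ∀ (c : ℂ) f, T (c • f) =ᵐ[μ] fun x => c * T f x)
    (hm : ∀ f, AEStronglyMeasurable (T f) μ)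
    (hC : ∀ f, ∀ᵐ x ∂μ, ‖T f x‖ ≤ C * ‖f‖) :
    ∃ S : L2 →L[ℂ] L2, ∀ f, S f =ᵐ[μ] T f := by
  have hL : ∀ f, MemLp (T f) 2 μ := fun f => MemLp.of_bound (hm f) _ (hC f)
  refine ⟨LinearMap.mkContinuous
    { toFun := fun f => (hL f).toLp
      map_add' := fun f g => ?_
      map_smul' := fun c f => ?_ }
    ((measureUnivNNReal μ : ℝ) ^ (2 : ℝ≥0∞).toReal⁻¹ * |C|) fun f => ?_, fun f => (hL f).coeFn_toLp⟩
  · rw [← MemLp.toLp_add]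
    exact MemLp.toLp_congr _ _ (hadd f g)
  · rw [RingHom.id_apply, ← MemLp.toLp_const_smul]
    exact MemLp.toLp_congr _ _ (hsmul c f)
  · rw [mul_assoc]
    refine Lp.norm_le_of_ae_bound (by positivity) ?_
    filter_upwards [(hL f).coeFn_toLp, hC f] with x h₁ h₂
    change ‖((hL f).toLp) x‖ ≤ _
    rw [h₁]
    exact h₂.trans (mul_le_mul_of_nonneg_right (le_abs_self C) (norm_nonneg f))

section PrimitiveMul

variable {y k : ℝ → ℂ} (H : IsPrimitive y k)
include H

theorem primitive_mul_add (f g : L2) (x : ℝ) :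
    primitive (fun t => y t * (f + g : L2) t) x
      = primitive (fun t => y t * f t) x + primitive (fun t => y t * g t) x := by
  rw [← primitive_add (H.integrable_mul (integrable_of_L2 f)) (H.integrable_mul (integrable_of_L2 g))]
  refine congrFun (primitive_congr ?_) x
  filter_upwards [Lp.coeFn_add f g] with t ht
  rw [ht, Pi.add_apply, mul_add]

/-- The bound is uniform in `x`: `y` is bounded, and on a finite measure space the `L¹` norm is
controlled by the `L²` norm. -/
theorem norm_primitive_mul_le : ∃ C : ℝ, 0 ≤ C ∧ ∀ (f : L2) (x : ℝ),
    ‖primitive (fun t => y t * f t) x‖ ≤ C * ‖f‖ := by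
  obtain ⟨C, hC⟩ := H.exists_bound
  have hC0 : 0 ≤ C := (norm_nonneg _).trans (hC 0)
  refine ⟨C * (μ univ ^ ((1 : ℝ) / 2)).toReal, by positivity, fun f x => ?_⟩
  have hi := integrable_of_L2 f
  refine (norm_primitive_le (H.integrable_mul hi) x).trans ?_
  rw [mul_assoc]
  refine le_trans ?_ (mul_le_mul_of_nonneg_left (integral_norm_le f) hC0)
  rw [← integral_const_mul]
  refine integral_mono (H.integrable_mul hi).norm (hi.norm.const_mul C) fun t => ?_
  simp only [norm_mul]
  exact mul_le_mul_of_nonneg_right (hC t) (norm_nonneg _)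

end PrimitiveMul

theorem primitive_mul_smul (y : ℝ → ℂ) (c : ℂ) (f : L2) (x : ℝ) :
    primitive (fun t => y t * (c • f : L2) t) x = c * primitive (fun t => y t * f t) x := by
  rw [← primitive_const_mul]
  refine congrFun (primitive_congr ?_) x
  filter_upwards [Lp.coeFn_smul c f] with t ht
  rw [ht, Pi.smul_apply, smul_eq_mul]
  ring

/-- The operator that maps a function to its primitive. -/
theorem exists_primitive_operator : ∃ V : L2 →L[ℂ] L2, ∀ f, V f =ᵐ[μ] primitive f := by
  have H := isPrimitive_const 1
  obtain ⟨C, -, hC⟩ := norm_primitive_mul_le H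
  obtain ⟨V, hV⟩ := exists_continuousLinearMap
    (fun f => primitive (fun t => (fun _ => (1 : ℂ)) t * f t)) C
    (fun f g => Filter.Eventually.of_forall (primitive_mul_add H f g))
    (fun c f => Filter.Eventually.of_forall (primitive_mul_smul _ c f))
    (fun f => (continuous_primitive (H.integrable_mul (integrable_of_L2 f))).aestronglyMeasurable)
    (fun f => Filter.Eventually.of_forall (hC f))
  exact ⟨V, fun f => by simpa only [one_mul] using hV f⟩

/-- The bilinear pairing with `m` is the inner product with its conjugate. It lets identities pass
from test functions to their closure. -/
theorem continuous_integral_mul {m : ℝ → ℂ} (hm : MemLp m 2 μ) :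
    Continuous fun w : L2 => ∫ x, m x * w x ∂μ := by
  have hc : MemLp (fun x => (starRingEnd ℂ) (m x)) 2 μ := hm.star
  have e : (fun w : L2 => ∫ x, m x * w x ∂μ) = fun w : L2 => inner ℂ (hc.toLp _) w := by
    funext w
    rw [L2.inner_def]
    refine integral_congr_ae ?_
    filter_upwards [hc.coeFn_toLp] with x hx
    rw [hx, RCLike.inner_apply, Complex.conj_conj, mul_comm]
  rw [e]
  fun_prop

/-! ### The space `H¹₀(0, π)` -/

theorem testPair_fst_ae (θ : 𝓓(Ω, ℂ)) : (testPair θ).1 =ᵐ[μ] θ :=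
  (memLp_testFunction θ).coeFn_toLp

theorem testPair_snd_ae (θ : 𝓓(Ω, ℂ)) : (testPair θ).2 =ᵐ[μ] deriv θ :=
  (memLp_deriv_testFunction θ).coeFn_toLp

theorem isPrimitive_test (θ : 𝓓(Ω, ℂ)) : IsPrimitive θ (deriv θ) :=
  isPrimitive_testFunction θ.contDiff θ.hasCompactSupport θ.tsupport_subset

/-- Integration by parts in `H¹₀(0, π)`. -/
theorem integral_add_integral_eq_zero_of_mem_H10 {u v : L2} (h : (u, v) ∈ H10) {m k : ℝ → ℂ}
    (H : IsPrimitive m k) (hk : MemLp k 2 μ) :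
    ∫ x, m x * v x ∂μ + ∫ x, k x * u x ∂μ = 0 := by
  have hcl : IsClosed {w : L2 × L2 | ∫ x, m x * w.2 x ∂μ + ∫ x, k x * w.1 x ∂μ = 0} :=
    isClosed_eq (((continuous_integral_mul (H.memLp 2)).comp continuous_snd).add
      ((continuous_integral_mul hk).comp continuous_fst)) continuous_const
  refine closure_minimal ?_ hcl h
  rintro _ ⟨θ, rfl⟩
  have K := isPrimitive_test θ
  have e := (H.mul K).integral_eq
  have i₁ : Integrable (fun x => k x * θ x) μ := by
    simp_rw [mul_comm (k _)]
    exact K.integrable_mul H.integrable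
  rw [integral_add i₁ (H.integrable_mul K.integrable), testFunction_zero, testFunction_pi, mul_zero,
    mul_zero, sub_zero] at e
  have e₁ : ∫ x, m x * (testPair θ).2 x ∂μ = ∫ x, m x * deriv θ x ∂μ :=
    integral_congr_ae ((testPair_snd_ae θ).mono fun x hx => by simp only [hx])
  have e₂ : ∫ x, k x * (testPair θ).1 x ∂μ = ∫ x, k x * θ x ∂μ :=
    integral_congr_ae ((testPair_fst_ae θ).mono fun x hx => by simp only [hx])
  rw [mem_ofPred_eq, e₁, e₂, add_comm]
  exact e

/-- A real test function, seen as a complex one. -/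
noncomputable def ofRealTest (θ : 𝓓(Ω, ℝ)) : 𝓓(Ω, ℂ) :=
  ⟨fun x => (θ x : ℂ), Complex.ofRealCLM.contDiff.comp θ.contDiff,
    θ.hasCompactSupport.comp_left Complex.ofReal_zero,
    (closure_mono (Function.support_comp_subset (g := Complex.ofReal) Complex.ofReal_zero θ)).trans
      θ.tsupport_subset⟩

theorem deriv_ofRealTest (θ : 𝓓(Ω, ℝ)) :
    deriv (ofRealTest θ) = fun x => ((deriv θ x : ℝ) : ℂ) := by
  funext x
  exact (differentiable_testFunction θ x).hasDerivAt.ofReal_comp.deriv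

/-- The derivatives of test functions are dense in the functions with integral zero. -/
theorem mem_closure_range_deriv {v : L2} (hv : ∫ x, v x ∂μ = 0) :
    v ∈ (LinearMap.range (LinearMap.snd ℂ L2 L2 ∘ₗ testPair)).topologicalClosure := by
  -- By du Bois-Reymond, a function orthogonal to all derivatives of test functions is constant,
  -- hence orthogonal to every `v` of mean zero.
  rw [← Submodule.orthogonal_orthogonal_eq_closure, Submodule.mem_orthogonal]
  intro w hw
  rw [Submodule.mem_orthogonal] at hw
  obtain ⟨c, hc⟩ := ae_eq_const_of_integral_deriv_smul_eq_zero (integrable_of_L2 w) (by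
    intro θ
    have h := hw _ (LinearMap.mem_range_self _ (ofRealTest θ))
    rw [L2.inner_def] at h
    rw [← h]
    refine integral_congr_ae ?_
    filter_upwards [testPair_snd_ae (ofRealTest θ)] with x hx
    change _ = inner ℂ ((testPair (ofRealTest θ)).2 x) (w x)
    rw [hx, deriv_ofRealTest, RCLike.inner_apply, Complex.conj_ofReal, mul_comm,
      Complex.real_smul])
  rw [L2.inner_def]
  have e : ∫ x, inner ℂ (w x) (v x) ∂μ = ∫ x, (starRingEnd ℂ) c * v x ∂μ := by
    refine integral_congr_ae ?_
    filter_upwards [hc] with x hx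
    rw [hx, RCLike.inner_apply, mul_comm]
  rw [e, integral_const_mul, hv, mul_zero]

/-- The closure definition becomes a pair of boundary values. Integration by parts against `1` and
against `x` extracts them; conversely a derivative of mean zero is a limit of `θ'`, and taking
primitives is continuous. -/
theorem mem_H10_iff {u v : L2} : (u, v) ∈ H10 ↔
    ∃ f, IsPrimitive f v ∧ f 0 = 0 ∧ f Real.pi = 0 ∧ u =ᵐ[μ] f := by
  constructor
  · intro h
    obtain ⟨f, hf, huf⟩ := (isWeakDeriv_of_mem_H10 h).exists_isPrimitive (integrable_of_L2 u)
      (integrable_of_L2 v)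
    have e₁ := integral_add_integral_eq_zero_of_mem_H10 h (isPrimitive_const 1) MemLp.zero'
    -- Pairing with the constant `1` gives `f π = f 0`.
    simp only [one_mul, zero_mul, integral_zero, add_zero, hf.integral_eq] at e₁
    have e₂ := integral_add_integral_eq_zero_of_mem_H10 h isPrimitive_id (memLp_const 1)
    have e₃ := (isPrimitive_id.mul hf).integral_eq
    have i₁ : Integrable (fun x => (1 : ℂ) * f x) μ := by
      simpa only [one_mul] using hf.integrable_self
    have e₄ : ∫ x, (1 : ℂ) * u x ∂μ = ∫ x, (1 : ℂ) * f x ∂μ :=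
      integral_congr_ae (huf.mono fun x hx => by simp only [hx])
    -- The product rule for `x f` has boundary term `π f(π)`, while integration by parts in `H10`
    -- gives zero.
    rw [integral_add i₁ (isPrimitive_id.integrable_mul hf.integrable), ← e₄, add_comm, e₂,
      primitive_zero, primitive_pi, zero_mul, sub_zero] at e₃
    have hpi : f Real.pi = 0 := by
      have : (∫ _, (1 : ℂ) ∂μ) ≠ 0 := by
        simp [Real.pi_pos.le, Real.pi_ne_zero, Measure.real]
      exact (mul_eq_zero.1 e₃.symm).resolve_left this
    rw [hpi, zero_sub, neg_eq_zero] at e₁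
    exact ⟨f, hf, e₁, hpi, huf⟩
  · rintro ⟨f, hf, h0, hpi, huf⟩
    obtain ⟨V, hV⟩ := exists_primitive_operator
    have hu : u = V v := by
      refine Lp.ext ?_
      filter_upwards [huf, hV v] with x h₁ h₂
      rw [h₁, h₂, hf.eq_add x, h0, zero_add]
    have hv := mem_closure_range_deriv (v := v) (by rw [hf.integral_eq, h0, hpi, sub_zero])
    rw [hu]
    refine map_mem_closure (f := fun w : L2 => (V w, w)) (by fun_prop) hv ?_
    rintro _ ⟨θ, rfl⟩
    refine ⟨θ, Prod.ext (Lp.ext ?_) rfl⟩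
    have K := isPrimitive_test θ
    filter_upwards [testPair_fst_ae θ, hV (testPair θ).2] with x h₁ h₂
    change (testPair θ).1 x = V (testPair θ).2 x
    rw [h₁, h₂, primitive_congr (testPair_snd_ae θ), K.eq_add x, testFunction_zero, zero_add]

/-! ### The scalar operator as a first order system -/

/-- The coefficient `1 / γ`. -/
noncomputable def invCoeff (γ : LInf) (x : ℝ) : ℂ := ((γ x)⁻¹ : ℝ)

/-- The coefficient `γ₀ - z`. -/
noncomputable def shiftCoeff (γ₀ : LInf) (z : ℂ) (x : ℝ) : ℂ := (γ₀ x : ℂ) - z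

theorem aestronglyMeasurable_invCoeff (γ : LInf) : AEStronglyMeasurable (invCoeff γ) μ :=
  Complex.continuous_ofReal.comp_aestronglyMeasurable
    (Lp.aestronglyMeasurable γ).aemeasurable.inv.aestronglyMeasurable

theorem aestronglyMeasurable_shiftCoeff (γ₀ : LInf) (z : ℂ) :
    AEStronglyMeasurable (shiftCoeff γ₀ z) μ :=
  (Complex.continuous_ofReal.comp_aestronglyMeasurable (Lp.aestronglyMeasurable γ₀)).sub
    aestronglyMeasurable_const

theorem norm_invCoeff_le {γ : LInf} {c : ℝ} (hc : 0 < c) (h : ∀ᵐ x ∂μ, c ≤ γ x) :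
    ∀ᵐ x ∂μ, ‖invCoeff γ x‖ ≤ c⁻¹ := by
  filter_upwards [h] with x hx
  rw [invCoeff, Complex.norm_real, Real.norm_eq_abs, abs_of_pos (inv_pos.2 (hc.trans_le hx))]
  exact inv_anti₀ hc hx

theorem exists_isFundamental {γ : LInf} (γ₀ : LInf) (hγ : ∃ c : ℝ, 0 < c ∧ ∀ᵐ x ∂μ, c ≤ γ x)
    (z : ℂ) : ∃ y₁ w₁ y₂ w₂, IsFundamental (invCoeff γ) (shiftCoeff γ₀ z) y₁ w₁ y₂ w₂ := by
  obtain ⟨c, hc, h⟩ := hγ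
  obtain ⟨C, hC⟩ := exists_bound_LInf γ₀
  have h₁ : ∀ᵐ x ∂μ, ‖invCoeff γ x‖ ≤ max c⁻¹ (C + ‖z‖) :=
    (norm_invCoeff_le hc h).mono fun x hx => hx.trans (le_max_left _ _)
  have h₂ : ∀ᵐ x ∂μ, ‖shiftCoeff γ₀ z x‖ ≤ max c⁻¹ (C + ‖z‖) := by
    filter_upwards [hC] with x hx
    refine ((norm_sub_le _ _).trans ?_).trans (le_max_right _ _)
    rw [Complex.norm_real]
    exact add_le_add_left hx _
  have ex := exists_isSolution_zero (aestronglyMeasurable_invCoeff γ)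
    (aestronglyMeasurable_shiftCoeff γ₀ z) h₁ h₂
  obtain ⟨y₁, w₁, s₁, p₁, q₁⟩ := ex 0 1
  obtain ⟨y₂, w₂, s₂, p₂, q₂⟩ := ex 1 0
  exact ⟨y₁, w₁, y₂, w₂, s₁, s₂, p₁, q₁, p₂, q₂⟩

theorem memLp_invCoeff_mul {γ : LInf} (hγ : ∃ c : ℝ, 0 < c ∧ ∀ᵐ x ∂μ, c ≤ γ x) {W k : ℝ → ℂ}
    (hW : IsPrimitive W k) : MemLp (fun x => invCoeff γ x * W x) 2 μ := by
  obtain ⟨c, hc, h⟩ := hγ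
  obtain ⟨C, hC⟩ := hW.exists_bound
  refine MemLp.of_bound ((aestronglyMeasurable_invCoeff γ).mul hW.continuous.aestronglyMeasurable)
    (c⁻¹ * C) ?_
  filter_upwards [norm_invCoeff_le hc h] with x hx
  rw [norm_mul]
  exact mul_le_mul hx (hC x) (norm_nonneg _) (inv_pos.2 hc).le

/-- `(u, f + z u)` is in the graph of the scalar operator if and only if `u` is the first component
of a solution of the first order system that vanishes at the end points. -/
theorem mem_scalarGraph_iff {γ : LInf} (γ₀ : LInf) (hγ : ∃ c : ℝ, 0 < c ∧ ∀ᵐ x ∂μ, c ≤ γ x)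
    (z : ℂ) {u f : L2} : (u, f + z • u) ∈ scalarGraph γ γ₀ ↔
    ∃ U W, IsSolution (invCoeff γ) (shiftCoeff γ₀ z) f U W ∧ U 0 = 0 ∧ U Real.pi = 0 ∧
      u =ᵐ[μ] U := by
  have hγ' := hγ
  obtain ⟨c, hc, h⟩ := hγ'
  have hg : ∀ U : ℝ → ℂ, u =ᵐ[μ] U → (coeffMul γ₀ u - (f + z • u) : L2) =ᵐ[μ]
      fun x => shiftCoeff γ₀ z x * U x - f x := by
    intro U hU
    filter_upwards [coeffMul_ae γ₀ u, Lp.coeFn_sub (coeffMul γ₀ u) (f + z • u),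
      Lp.coeFn_add f (z • u), Lp.coeFn_smul z u, hU] with x h₁ h₂ h₃ h₄ h₅
    rw [h₂, Pi.sub_apply, h₁, h₃, Pi.add_apply, h₄, Pi.smul_apply, h₅, shiftCoeff, smul_eq_mul]
    ring
  constructor
  · rintro ⟨v, hv, hw⟩
    obtain ⟨U, hU, h0, hpi, huU⟩ := mem_H10_iff.1 hv
    -- `W` is the continuous representative of `γ v`; `v` itself need not have one.
    obtain ⟨W, hW, hvW⟩ := hw.exists_isPrimitive (integrable_of_L2 _) (integrable_of_L2 _)
    refine ⟨U, W, ⟨hU.congr ?_, hW.congr (hg U huU)⟩, h0, hpi, huU⟩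
    filter_upwards [h, hvW, coeffMul_ae γ v] with x h₁ h₂ h₃
    have : (γ x : ℂ) ≠ 0 := Complex.ofReal_ne_zero.2 (hc.trans_le h₁).ne'
    rw [← h₂, h₃, invCoeff, Complex.ofReal_inv, inv_mul_cancel_left₀ this]
  · rintro ⟨U, W, hs, h0, hpi, huU⟩
    have hm := memLp_invCoeff_mul hγ hs.snd
    refine ⟨hm.toLp, mem_H10_iff.2 ⟨U, hs.fst.congr hm.coeFn_toLp.symm, h0, hpi, huU⟩, ?_⟩
    refine hs.snd.isWeakDeriv.congr ?_ (hg U huU).symm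
    filter_upwards [h, coeffMul_ae γ hm.toLp, hm.coeFn_toLp] with x h₁ h₂ h₃
    have : (γ x : ℂ) ≠ 0 := Complex.ofReal_ne_zero.2 (hc.trans_le h₁).ne'
    rw [h₂, h₃, invCoeff, Complex.ofReal_inv, mul_inv_cancel_left₀ this]

end Cascade

/-! ### Unbounded operators in terms of their graphs -/

namespace UnboundedOp

variable {E : Type*} [NormedAddCommGroup E] [NormedSpace ℂ E] {T : E →ₗ.[ℂ] E} {z : ℂ} {x y : E}

theorem mem_eigenspace_iff : x ∈ eigenspace T z ↔ (x, z • x) ∈ T.graph := by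
  rw [eigenspace, Submodule.mem_map, LinearPMap.mem_graph_iff]
  constructor
  · rintro ⟨v, hv, rfl⟩
    exact ⟨v, rfl, sub_eq_zero.1 hv⟩
  · rintro ⟨v, rfl, hv⟩
    exact ⟨v, sub_eq_zero.2 hv, rfl⟩

theorem mem_graph_add_smul_iff :
    (x, y + z • x) ∈ T.graph ↔ ∃ h : x ∈ T.domain, T ⟨x, h⟩ - z • x = y := by
  rw [LinearPMap.mem_graph_iff]
  constructor
  · rintro ⟨v, rfl, hv⟩
    exact ⟨v.2, sub_eq_iff_eq_add.2 hv⟩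
  · rintro ⟨h, e⟩
    exact ⟨⟨x, h⟩, rfl, sub_eq_iff_eq_add.1 e⟩

theorem eigenvalues_subset_spectrum : eigenvalues T ⊆ spectrum T := by
  rintro z ⟨x, hx, hne⟩ ⟨R, -, hR⟩
  rw [mem_eigenspace_iff, LinearPMap.mem_graph_iff] at hx
  obtain ⟨v, rfl, hv⟩ := hx
  refine hne ?_
  rw [← hR v]
  change T v = z • (v : E) at hv
  rw [hv, sub_self, map_zero]

/-- A bounded right inverse of an injective `T - z` is the resolvent. -/
theorem notMem_spectrum (R : E →L[ℂ] E) (h : ∀ y, (R y, y + z • R y) ∈ T.graph)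
    (hz : z ∉ eigenvalues T) : z ∉ spectrum T := by
  refine not_not_intro ⟨R, fun y => mem_graph_add_smul_iff.1 (h y), fun x => ?_⟩
  by_contra hne
  -- As `R` is a right inverse of `T - z`, the vector `R (T - z) x - x` lies in the kernel of `T -
  -- z`.
  refine hz ⟨R (T x - z • (x : E)) - x, mem_eigenspace_iff.2 ?_, sub_ne_zero.2 hne⟩
  have e := T.graph.sub_mem (h (T x - z • (x : E))) (T.mem_graph x)
  convert e using 1
  refine Prod.ext rfl ?_
  simp only [Prod.mk_sub_mk, smul_sub]
  abel

end UnboundedOp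

namespace Cascade

open UnboundedOp

theorem IsWeakDeriv.unique {u v w : L2} (hv : IsWeakDeriv u v) (hw : IsWeakDeriv u w) : v = w := by
  have h := hv.add (hw.smul (-1))
  have e : u + (-1 : ℂ) • u = 0 := by rw [neg_one_smul, add_neg_cancel]
  rw [e, neg_one_smul, ← sub_eq_add_neg] at h
  exact sub_eq_zero.1 h.eq_zero

/-! ### Unique continuation -/

/-- On an interval where `U` vanishes, the derivative of `U * conj W` is `‖W‖² / γ` and has integral
zero; positivity of `γ` then forces `W` to vanish almost everywhere there. -/
theorem IsSolution.exists_zero {γ : LInf} (hγ : ∃ c : ℝ, 0 < c ∧ ∀ᵐ x ∂μ, c ≤ γ x)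
    {b U W : ℝ → ℂ} (h : IsSolution (invCoeff γ) b 0 U W) {ω : Set ℝ} (hω : IsOpen ω)
    (hne : ω.Nonempty) (hsub : ω ⊆ Ioo 0 Real.pi) (hU : ∀ᵐ x ∂volume.restrict ω, U x = 0) :
    ∃ x, U x = 0 ∧ W x = 0 := by
  have hU0 : ∀ x ∈ ω, U x = 0 := Measure.eqOn_open_of_ae_eq hU hω h.fst.continuous.continuousOn
    continuousOn_const
  obtain ⟨x, hx⟩ := hne
  obtain ⟨y, hxy, hy⟩ : ∃ y > x, Icc x y ⊆ ω := by
    obtain ⟨ε, hε, hb⟩ := Metric.isOpen_iff.1 hω x hx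
    refine ⟨x + ε / 2, by linarith, fun t ht => hb ?_⟩
    rw [Real.ball_eq_Ioo]
    exact ⟨by linarith [ht.1], by linarith [ht.2]⟩
  have hI : Ioc x y ⊆ ω := Ioc_subset_Icc_self.trans hy
  set k : ℝ → ℂ := fun t => invCoeff γ t * W t * (starRingEnd ℂ) (W t)
    + U t * (starRingEnd ℂ) (b t * U t - (0 : ℝ → ℂ) t) with hk
  have K : IsPrimitive (fun t => U t * (starRingEnd ℂ) (W t)) k := h.fst.mul h.snd.conj
  have e : ∫ t in Ioc x y, k t ∂μ = 0 := by
    rw [← intervalIntegral.integral_of_le hxy.le,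
      ← intervalIntegral.integral_Iic_sub_Iic K.integrable.integrableOn K.integrable.integrableOn]
    have e₁ := K.eq_add x
    have e₂ := K.eq_add y
    rw [hU0 x hx, zero_mul] at e₁
    rw [hU0 y (hy (right_mem_Icc.2 hxy.le)), zero_mul] at e₂
    change primitive k y - primitive k x = 0
    linear_combination e₁ - e₂
  have hkr : ∀ t ∈ Ioc x y, k t = (((γ t)⁻¹ * ‖W t‖ ^ 2 : ℝ) : ℂ) := by
    intro t ht
    rw [hk]
    simp only [hU0 t (hI ht), zero_mul, add_zero, mul_assoc, Complex.mul_conj, invCoeff,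
      Complex.normSq_eq_norm_sq]
    push_cast
    ring
  have hμ : μ.restrict (Ioc x y) = volume.restrict (Ioc x y) := by
    rw [Measure.restrict_restrict measurableSet_Ioc, inter_eq_left.2 (hI.trans hsub)]
  have hIk : IntegrableOn k (Ioc x y) μ := K.integrable.integrableOn
  have hIr : IntegrableOn (fun t => (γ t)⁻¹ * ‖W t‖ ^ 2) (Ioc x y) μ := by
    refine (hIk.re).congr ?_
    refine (ae_restrict_mem measurableSet_Ioc).mono fun t ht => ?_
    simp only [hkr t ht]
    exact RCLike.ofReal_re (K := ℂ) _
  rw [setIntegral_congr_fun measurableSet_Ioc hkr, integral_complex_ofReal,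
    Complex.ofReal_eq_zero] at e
  obtain ⟨c, hc, hγc⟩ := hγ
  have hγ' : ∀ᵐ t ∂μ.restrict (Ioc x y), c ≤ γ t := ae_restrict_of_ae hγc
  have e' := (setIntegral_eq_zero_iff_of_nonneg_ae (by
    filter_upwards [hγ'] with t ht
    have := hc.trans_le ht
    positivity) hIr).1 e
  have hW : ∀ᵐ t ∂volume.restrict (Ioc x y), W t = 0 := by
    rw [← hμ]
    filter_upwards [hγ', e'] with t h₁ h₂
    have h₃ : (γ t)⁻¹ ≠ 0 := inv_ne_zero (hc.trans_le h₁).ne'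
    simpa [h₃] using h₂
  -- The interval has positive measure, so a property that holds almost everywhere holds at some
  -- point of it.
  have hnb : (ae (volume.restrict (Ioc x y))).NeBot := by
    rw [ae_restrict_neBot]
    simp [hxy]
  obtain ⟨t, h₁, h₂⟩ := (hW.and (ae_restrict_mem measurableSet_Ioc)).exists
  exact ⟨t, hU0 t (hI h₂), h₁⟩

section Scalar

variable {γ γ₀ : LInf} {z : ℂ} {y₁ w₁ y₂ w₂ : ℝ → ℂ}

/-- A common zero of `y₁` and `w₁` would make the Wronskian vanish. -/
theorem IsFundamental.not_ae_eq_zero (hγ : ∃ c : ℝ, 0 < c ∧ ∀ᵐ x ∂μ, c ≤ γ x) {b : ℝ → ℂ}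
    (F : IsFundamental (invCoeff γ) b y₁ w₁ y₂ w₂) {ω : Set ℝ} (hω : IsOpen ω)
    (hne : ω.Nonempty) (hsub : ω ⊆ Ioo 0 Real.pi) :
    ¬ ∀ᵐ x ∂volume.restrict ω, y₁ x = 0 := by
  intro h
  obtain ⟨x, e₁, e₂⟩ := F.sol₁.exists_zero hγ hω hne hsub h
  have e := F.wronskian x
  rw [e₁, e₂, mul_zero, mul_zero, sub_zero] at e
  exact zero_ne_one e

/-! ### The spectral theory of the scalar operator -/

/-- Shooting from `0`: the left boundary condition leaves only multiples of `y₁`, and the right one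
is a condition on the multiple. -/
theorem mem_scalarGraph_smul_iff (hγ : ∃ c : ℝ, 0 < c ∧ ∀ᵐ x ∂μ, c ≤ γ x)
    (F : IsFundamental (invCoeff γ) (shiftCoeff γ₀ z) y₁ w₁ y₂ w₂) {u : L2} :
    (u, z • u) ∈ scalarGraph γ γ₀ ↔
      ∃ c : ℂ, c * y₁ Real.pi = 0 ∧ u =ᵐ[μ] fun x => c * y₁ x := by
  have h := mem_scalarGraph_iff γ₀ hγ z (u := u) (f := 0)
  rw [zero_add] at h
  rw [h]
  constructor
  · rintro ⟨U, W, hs, h0, hpi, hu⟩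
    have e := F.eq_mul (hs.congr (Lp.coeFn_zero ℂ 2 μ)) h0
    refine ⟨W 0, by rw [← (e _).1, hpi], hu.trans (Filter.Eventually.of_forall fun x => (e x).1)⟩
  · rintro ⟨c, hc, hu⟩
    refine ⟨_, _, (F.sol₁.const_mul c).congr ?_, by rw [F.y₁_zero, mul_zero], hc, hu⟩
    filter_upwards [Lp.coeFn_zero ℂ 2 μ] with x hx
    rw [hx, Pi.zero_apply, mul_zero]

theorem isEigenvector_scalarOp_iff {u : L2} :
    IsEigenvector (scalarOp γ γ₀) z u ↔ (u, z • u) ∈ scalarGraph γ γ₀ ∧ u ≠ 0 := by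
  rw [IsEigenvector, mem_eigenspace_iff, scalarOp_graph]

theorem mem_eigenvalues_scalarOp_iff (hγ : ∃ c : ℝ, 0 < c ∧ ∀ᵐ x ∂μ, c ≤ γ x)
    (F : IsFundamental (invCoeff γ) (shiftCoeff γ₀ z) y₁ w₁ y₂ w₂) :
    z ∈ eigenvalues (scalarOp γ γ₀) ↔ y₁ Real.pi = 0 := by
  constructor
  · rintro ⟨u, hu⟩
    obtain ⟨hu, hne⟩ := isEigenvector_scalarOp_iff.1 hu
    obtain ⟨c, hc, huc⟩ := (mem_scalarGraph_smul_iff hγ F).1 hu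
    refine (mul_eq_zero.1 hc).resolve_left ?_
    rintro rfl
    refine hne ((Lp.eq_zero_iff_ae_eq_zero).2 (huc.trans ?_))
    exact Filter.Eventually.of_forall fun x => zero_mul _
  · intro h
    have hm := F.sol₁.fst.memLp 2
    refine ⟨hm.toLp, isEigenvector_scalarOp_iff.2 ⟨(mem_scalarGraph_smul_iff hγ F).2
      ⟨1, by rw [h, mul_zero], hm.coeFn_toLp.trans
        (Filter.Eventually.of_forall fun x => (one_mul _).symm)⟩, fun h0 => ?_⟩⟩
    refine F.not_ae_eq_zero hγ isOpen_Ioo ⟨1, one_pos, by linarith [Real.pi_gt_three]⟩ le_rfl ?_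
    exact hm.coeFn_toLp.symm.trans ((Lp.eq_zero_iff_ae_eq_zero).1 h0)

/-- The Fredholm alternative. Necessity is the Lagrange identity with `y₁`, whose boundary terms
vanish; sufficiency is variation of parameters, whose value at `π` is a multiple of `∫ y₁ f`. -/
theorem exists_mem_scalarGraph_iff (hγ : ∃ c : ℝ, 0 < c ∧ ∀ᵐ x ∂μ, c ≤ γ x)
    (F : IsFundamental (invCoeff γ) (shiftCoeff γ₀ z) y₁ w₁ y₂ w₂) (hpi : y₁ Real.pi = 0)
    {f : L2} : (∃ u : L2, (u, f + z • u) ∈ scalarGraph γ γ₀) ↔ ∫ x, y₁ x * f x ∂μ = 0 := by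
  constructor
  · rintro ⟨u, hu⟩
    obtain ⟨U, W, hs, h0, hUpi, -⟩ := (mem_scalarGraph_iff γ₀ hγ z).1 hu
    have e := (hs.lagrange F.sol₁).integral_eq
    rw [hUpi, h0, hpi, F.y₁_zero] at e
    simp only [Pi.zero_apply, mul_zero, zero_mul, sub_zero] at e
    rw [← e]
    exact integral_congr_ae (Filter.Eventually.of_forall fun x => mul_comm _ _)
  · intro h
    -- Any initial slope would do, since `y₁` vanishes at both ends.
    have hs := F.isSolution_variation (integrable_of_L2 f) 0
    refine ⟨(hs.fst.memLp 2).toLp, (mem_scalarGraph_iff γ₀ hγ z).2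
      ⟨_, _, hs, ?_, ?_, (hs.fst.memLp 2).coeFn_toLp⟩⟩
    · rw [F.y₁_zero, primitive_zero, primitive_zero]
      ring
    · rw [hpi, primitive_pi (fun t => y₁ t * f t), h]
      ring

/-- One formula covers the resolvent, with `Y = y₁` and `Z = y₂`, and its derivative, with `Y = w₁ /
γ` and `Z = w₂ / γ`. -/
theorem exists_variation_operator (H₁ : ∃ k, IsPrimitive y₁ k) (H₂ : ∃ k, IsPrimitive y₂ k)
    (r : ℂ) {Y Z : ℝ → ℂ} {B : ℝ} (hY : AEStronglyMeasurable Y μ) (hZ : AEStronglyMeasurable Z μ)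
    (hYB : ∀ᵐ x ∂μ, ‖Y x‖ ≤ B) (hZB : ∀ᵐ x ∂μ, ‖Z x‖ ≤ B) :
    ∃ S : L2 →L[ℂ] L2, ∀ f, S f =ᵐ[μ] fun x =>
      (primitive (fun t => y₂ t * f t) Real.pi - r * primitive (fun t => y₁ t * f t) Real.pi
        - primitive (fun t => y₂ t * f t) x) * Y x + primitive (fun t => y₁ t * f t) x * Z x := by
  obtain ⟨k₁, H₁⟩ := H₁
  obtain ⟨k₂, H₂⟩ := H₂
  obtain ⟨C₁, hC₁, h₁⟩ := norm_primitive_mul_le H₁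
  obtain ⟨C₂, hC₂, h₂⟩ := norm_primitive_mul_le H₂
  refine exists_continuousLinearMap _ ((C₂ + ‖r‖ * C₁ + C₂ + C₁) * B) (fun f g => ?_)
    (fun c f => ?_) (fun f => ?_) (fun f => ?_)
  · refine Filter.Eventually.of_forall fun x => ?_
    simp only [primitive_mul_add H₁, primitive_mul_add H₂]
    ring
  · refine Filter.Eventually.of_forall fun x => ?_
    simp only [primitive_mul_smul]
    ring
  · have c₁ := continuous_primitive (H₁.integrable_mul (integrable_of_L2 f))
    have c₂ := continuous_primitive (H₂.integrable_mul (integrable_of_L2 f))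
    exact ((continuous_const.sub c₂).aestronglyMeasurable.mul hY).add
      (c₁.aestronglyMeasurable.mul hZ)
  · filter_upwards [hYB, hZB] with x hY hZ
    have hB : 0 ≤ B := (norm_nonneg _).trans hY
    have e : (C₂ + ‖r‖ * C₁ + C₂ + C₁) * B * ‖f‖
        = (C₂ * ‖f‖ + ‖r‖ * (C₁ * ‖f‖) + C₂ * ‖f‖) * B + C₁ * ‖f‖ * B := by ring
    rw [e]
    refine (norm_add_le _ _).trans (add_le_add ?_ ?_)
    · rw [norm_mul]
      refine mul_le_mul ?_ hY (norm_nonneg _) (by positivity)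
      refine (norm_sub_le _ _).trans (add_le_add ((norm_sub_le _ _).trans
        (add_le_add (h₂ f _) ?_)) (h₂ f x))
      rw [norm_mul]
      exact mul_le_mul_of_nonneg_left (h₁ f _) (norm_nonneg r)
    · rw [norm_mul]
      exact mul_le_mul (h₁ f x) hZ (norm_nonneg _) (by positivity)

/-- If `z` is not an eigenvalue, then the resolvent and its derivative are bounded operators. -/
theorem exists_resolvent (hγ : ∃ c : ℝ, 0 < c ∧ ∀ᵐ x ∂μ, c ≤ γ x)
    (hz : z ∉ eigenvalues (scalarOp γ γ₀)) :
    ∃ R D : L2 →L[ℂ] L2, ∀ f, (R f, f + z • R f) ∈ scalarGraph γ γ₀ ∧ IsWeakDeriv (R f) (D f) := by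
  obtain ⟨y₁, w₁, y₂, w₂, F⟩ := exists_isFundamental γ₀ hγ z
  rw [mem_eigenvalues_scalarOp_iff hγ F] at hz
  obtain ⟨B₁, hB₁⟩ := F.sol₁.fst.exists_bound
  obtain ⟨B₂, hB₂⟩ := F.sol₂.fst.exists_bound
  obtain ⟨M₁, hM₁⟩ := F.sol₁.snd.exists_bound
  obtain ⟨M₂, hM₂⟩ := F.sol₂.snd.exists_bound
  have hγ' := hγ
  obtain ⟨c, hc, hγc⟩ := hγ'
  have ha := aestronglyMeasurable_invCoeff γ
  have hab : ∀ {w : ℝ → ℂ} {M : ℝ}, (∀ x, ‖w x‖ ≤ M) →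
      ∀ᵐ x ∂μ, ‖invCoeff γ x * w x‖ ≤ c⁻¹ * M := fun {w M} hw => by
    filter_upwards [norm_invCoeff_le hc hγc] with x hx
    rw [norm_mul]
    exact mul_le_mul hx (hw x) (norm_nonneg _) (inv_pos.2 hc).le
  -- With this ratio the initial slope below makes the solution vanish at `π`.
  set r : ℂ := y₂ Real.pi / y₁ Real.pi with hr
  obtain ⟨R, hR⟩ := exists_variation_operator ⟨_, F.sol₁.fst⟩ ⟨_, F.sol₂.fst⟩ r
    (B := max B₁ B₂) F.sol₁.fst.continuous.aestronglyMeasurable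
    F.sol₂.fst.continuous.aestronglyMeasurable
    (Filter.Eventually.of_forall fun x => (hB₁ x).trans (le_max_left _ _))
    (Filter.Eventually.of_forall fun x => (hB₂ x).trans (le_max_right _ _))
  obtain ⟨D, hD⟩ := exists_variation_operator ⟨_, F.sol₁.fst⟩ ⟨_, F.sol₂.fst⟩ r
    (B := max (c⁻¹ * M₁) (c⁻¹ * M₂)) (ha.mul F.sol₁.snd.continuous.aestronglyMeasurable)
    (ha.mul F.sol₂.snd.continuous.aestronglyMeasurable)
    ((hab hM₁).mono fun x hx => hx.trans (le_max_left _ _))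
    ((hab hM₂).mono fun x hx => hx.trans (le_max_right _ _))
  refine ⟨R, D, fun f => ?_⟩
  have hs := F.isSolution_variation (integrable_of_L2 f)
    (primitive (fun t => y₂ t * f t) Real.pi - r * primitive (fun t => y₁ t * f t) Real.pi)
  refine ⟨(mem_scalarGraph_iff γ₀ hγ z).2 ⟨_, _, hs, ?_, ?_, hR f⟩, ?_⟩
  · rw [F.y₁_zero, primitive_zero (fun t => y₁ t * f t)]
    ring
  · rw [hr]
    field_simp
    ring
  · refine hs.fst.isWeakDeriv.congr (hR f).symm ?_
    filter_upwards [hD f] with x hx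
    rw [hx]
    simp only [Pi.mul_apply]
    ring

theorem spectrum_scalarOp (hγ : ∃ c : ℝ, 0 < c ∧ ∀ᵐ x ∂μ, c ≤ γ x) :
    spectrum (scalarOp γ γ₀) = eigenvalues (scalarOp γ γ₀) := by
  refine Subset.antisymm (fun z hz => ?_) eigenvalues_subset_spectrum
  by_contra h
  obtain ⟨R, D, hR⟩ := exists_resolvent hγ h
  refine notMem_spectrum R (fun y => ?_) h hz
  rw [scalarOp_graph]
  exact (hR y).1

/-- The eigenvalues are real. -/
theorem conj_eq_of_mem_eigenvalues (hγ : ∃ c : ℝ, 0 < c ∧ ∀ᵐ x ∂μ, c ≤ γ x)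
    (F : IsFundamental (invCoeff γ) (shiftCoeff γ₀ z) y₁ w₁ y₂ w₂) (hpi : y₁ Real.pi = 0) :
    (starRingEnd ℂ) z = z := by
  -- Conjugation replaces `z` by its conjugate; the discrepancy is moved to the source term. The
  -- Lagrange identity with `y₁` then gives `(conj z - z) ∫ ‖y₁‖² = 0`.
  have hs : IsSolution (invCoeff γ) (shiftCoeff γ₀ z)
      (fun x => ((starRingEnd ℂ) z - z) * (starRingEnd ℂ) (y₁ x))
      (fun x => (starRingEnd ℂ) (y₁ x)) (fun x => (starRingEnd ℂ) (w₁ x)) := by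
    refine ⟨F.sol₁.fst.conj.congr ?_, F.sol₁.snd.conj.congr ?_⟩
    · refine Filter.Eventually.of_forall fun x => ?_
      simp only [map_mul, invCoeff, Complex.conj_ofReal]
    · refine Filter.Eventually.of_forall fun x => ?_
      simp only [map_mul, map_sub, shiftCoeff, Complex.conj_ofReal, Pi.zero_apply, map_zero]
      ring
  have e := (hs.lagrange F.sol₁).integral_eq
  have e' : ∫ x, (((starRingEnd ℂ) z - z) * (starRingEnd ℂ) (y₁ x) * y₁ x
      - (starRingEnd ℂ) (y₁ x) * (0 : ℝ → ℂ) x) ∂μ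
      = ((starRingEnd ℂ) z - z) * ((∫ x, ‖y₁ x‖ ^ 2 ∂μ : ℝ) : ℂ) := by
    rw [← integral_complex_ofReal, ← integral_const_mul]
    refine integral_congr_ae (Filter.Eventually.of_forall fun x => ?_)
    have h1 := Complex.mul_conj (y₁ x)
    rw [Complex.normSq_eq_norm_sq] at h1
    simp only [Pi.zero_apply, mul_zero, sub_zero]
    rw [← h1]
    ring
  rw [e'] at e
  simp only [hpi, F.y₁_zero, map_zero, mul_zero, zero_mul, sub_zero] at e
  refine sub_eq_zero.1 ((mul_eq_zero.1 e).resolve_right fun h => ?_)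
  rw [Complex.ofReal_eq_zero, integral_eq_zero_iff_of_nonneg (fun x => by positivity)
    ((F.sol₁.fst.memLp 2).integrable_norm_pow two_ne_zero)] at h
  refine F.not_ae_eq_zero hγ isOpen_Ioo ⟨1, one_pos, by linarith [Real.pi_gt_three]⟩ le_rfl ?_
  exact h.mono fun x hx => by simpa using hx

/-- For real `z` the conjugate of `y₁` solves the same system with the same initial data. -/
theorem conj_solution_eq (hγ : ∃ c : ℝ, 0 < c ∧ ∀ᵐ x ∂μ, c ≤ γ x)
    (F : IsFundamental (invCoeff γ) (shiftCoeff γ₀ z) y₁ w₁ y₂ w₂) (hpi : y₁ Real.pi = 0) (x : ℝ) :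
    (((y₁ x).re : ℝ) : ℂ) = y₁ x := by
  have hz := conj_eq_of_mem_eigenvalues hγ F hpi
  have hs : IsSolution (invCoeff γ) (shiftCoeff γ₀ z) 0
      (fun x => (starRingEnd ℂ) (y₁ x)) (fun x => (starRingEnd ℂ) (w₁ x)) := by
    refine ⟨F.sol₁.fst.conj.congr ?_, F.sol₁.snd.conj.congr ?_⟩
    · refine Filter.Eventually.of_forall fun x => ?_
      simp only [map_mul, invCoeff, Complex.conj_ofReal]
    · refine Filter.Eventually.of_forall fun x => ?_
      simp only [map_mul, map_sub, shiftCoeff, Complex.conj_ofReal, Pi.zero_apply, map_zero, hz]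
  have e := (F.eq_mul hs (by simp [F.y₁_zero]) x).1
  rw [F.w₁_zero, map_one, one_mul] at e
  exact Complex.conj_eq_iff_re.1 e

theorem toComplex_ae (φ : L2R) : toComplex φ =ᵐ[μ] fun x => (φ x : ℂ) :=
  ContinuousLinearMap.coeFn_compLp _ φ

theorem exists_isNormalizedEigenfunction (hγ : ∃ c : ℝ, 0 < c ∧ ∀ᵐ x ∂μ, c ≤ γ x)
    (hz : z ∈ eigenvalues (scalarOp γ γ₀)) : ∃ φ : L2R, IsNormalizedEigenfunction γ γ₀ z φ := by
  obtain ⟨y₁, w₁, y₂, w₂, F⟩ := exists_isFundamental γ₀ hγ z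
  have hpi := (mem_eigenvalues_scalarOp_iff hγ F).1 hz
  have hre := conj_solution_eq hγ F hpi
  have hm : MemLp (fun x => (y₁ x).re) 2 μ := (F.sol₁.fst.memLp 2).re
  set u : L2R := hm.toLp with hu
  have hu0 : u ≠ 0 := by
    intro h0
    refine F.not_ae_eq_zero hγ isOpen_Ioo ⟨1, one_pos, by linarith [Real.pi_gt_three]⟩ le_rfl ?_
    have := hm.coeFn_toLp.symm.trans ((Lp.eq_zero_iff_ae_eq_zero).1 h0)
    filter_upwards [this] with x hx
    rw [← hre x, hx]
    simp
  have hN : ‖u‖ ≠ 0 := norm_ne_zero_iff.2 hu0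
  have hφ : ‖(‖u‖⁻¹ • u : L2R)‖ = 1 := by
    rw [norm_smul, norm_inv, norm_norm, inv_mul_cancel₀ hN]
  refine ⟨‖u‖⁻¹ • u, isEigenvector_scalarOp_iff.2 ⟨?_, fun h0 => ?_⟩, hφ⟩
  · refine (mem_scalarGraph_smul_iff hγ F).2 ⟨(‖u‖⁻¹ : ℝ), by rw [hpi, mul_zero], ?_⟩
    filter_upwards [toComplex_ae (‖u‖⁻¹ • u : L2R), Lp.coeFn_smul ‖u‖⁻¹ u, hm.coeFn_toLp]
      with x h₁ h₂ h₃
    rw [h₁, h₂, Pi.smul_apply, h₃, smul_eq_mul, Complex.ofReal_mul, hre]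
  · have : (‖u‖⁻¹ • u : L2R) = 0 := by
      refine (Lp.eq_zero_iff_ae_eq_zero).2 ?_
      filter_upwards [toComplex_ae (‖u‖⁻¹ • u : L2R), (Lp.eq_zero_iff_ae_eq_zero).1 h0]
        with x h₁ h₂
      rw [h₁] at h₂
      exact Complex.ofReal_eq_zero.1 h₂
    rw [this, norm_zero] at hφ
    exact zero_ne_one hφ

end Scalar

end Cascade

namespace Cascade

open UnboundedOp

/-! ### Products with Lipschitz coefficients -/

theorem exists_isPrimitive_coeff {p dp : LInf} (hp : IsWeakDeriv p dp) :
    ∃ P, IsPrimitive P (fun x => (dp x : ℂ)) ∧ (fun x => (p x : ℂ)) =ᵐ[μ] P :=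
  hp.ofReal.exists_isPrimitive ((Lp.memLp p).integrable le_top).ofReal
    ((Lp.memLp dp).integrable le_top).ofReal

theorem IsWeakDeriv.coeffMul {p dp : LInf} (hp : IsWeakDeriv p dp) {u v : L2}
    (h : IsWeakDeriv u v) :
    IsWeakDeriv (coeffMul p u) (coeffMul dp u + coeffMul p v : L2) := by
  obtain ⟨P, hP, hpP⟩ := exists_isPrimitive_coeff hp
  obtain ⟨U, hU, huU⟩ := h.exists_isPrimitive (integrable_of_L2 u) (integrable_of_L2 v)
  refine (hP.mul hU).isWeakDeriv.congr ?_ ?_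
  · filter_upwards [hpP, huU, coeffMul_ae p u] with x h₁ h₂ h₃
    rw [h₃, h₂, ← h₁]
  · filter_upwards [hpP, huU, coeffMul_ae p v, coeffMul_ae dp u,
      Lp.coeFn_add (Cascade.coeffMul dp u) (Cascade.coeffMul p v)] with x h₁ h₂ h₃ h₄ h₅
    rw [h₅, Pi.add_apply, h₄, h₃, h₂, ← h₁]

theorem integrable_mul_L2 (u v : L2) : Integrable (fun x => u x * v x) μ :=
  (Lp.memLp u).integrable_mul (Lp.memLp v)

theorem integral_mul_add (u f g : L2) :
    ∫ x, u x * (f + g : L2) x ∂μ = ∫ x, u x * f x ∂μ + ∫ x, u x * g x ∂μ := by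
  rw [← integral_add (integrable_mul_L2 u f) (integrable_mul_L2 u g)]
  refine integral_congr_ae ?_
  filter_upwards [Lp.coeFn_add f g] with x hx
  rw [hx, Pi.add_apply, mul_add]

theorem integral_mul_smul (c : ℂ) (u f : L2) :
    ∫ x, u x * (c • f : L2) x ∂μ = c * ∫ x, u x * f x ∂μ := by
  rw [← integral_const_mul]
  refine integral_congr_ae ?_
  filter_upwards [Lp.coeFn_smul c f] with x hx
  rw [hx, Pi.smul_apply, smul_eq_mul]
  ring

/-- This is `∫ (p u²)' = 0`, the source of the term `p' / 2` in the coupling integral. -/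
theorem integral_mul_deriv_coeffMul {p dp : LInf} (hp : IsWeakDeriv p dp) {u v : L2}
    (h : (u, v) ∈ H10) :
    ∫ x, u x * coeffMul dp u x ∂μ + 2 * ∫ x, u x * coeffMul p v x ∂μ = 0 := by
  obtain ⟨P, hP, hpP⟩ := exists_isPrimitive_coeff hp
  obtain ⟨U, hU, h0, hpi, huU⟩ := mem_H10_iff.1 h
  have e := (hP.mul (hU.mul hU)).integral_eq
  rw [h0, hpi, mul_zero, mul_zero, mul_zero, sub_zero] at e
  rw [← integral_const_mul, ← integral_add (integrable_mul_L2 u _)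
    ((integrable_mul_L2 u _).const_mul 2), ← e]
  refine integral_congr_ae ?_
  filter_upwards [hpP, huU, coeffMul_ae p v, coeffMul_ae dp u] with x h₁ h₂ h₃ h₄
  rw [h₄, h₃, h₂, ← h₁]
  ring

/-! ### Normalized eigenfunctions -/

section Eigenfunction

variable {γ γ₀ : LInf} {z : ℂ} {φ : L2R}

theorem IsNormalizedEigenfunction.mem_graph (hφ : IsNormalizedEigenfunction γ γ₀ z φ) :
    (toComplex φ, z • toComplex φ) ∈ scalarGraph γ γ₀ :=
  (isEigenvector_scalarOp_iff.1 hφ.1).1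

theorem IsNormalizedEigenfunction.ne_zero (hφ : IsNormalizedEigenfunction γ γ₀ z φ) :
    toComplex φ ≠ 0 := hφ.1.2

theorem IsNormalizedEigenfunction.exists_fundamental (hφ : IsNormalizedEigenfunction γ γ₀ z φ)
    (hγ : ∃ c : ℝ, 0 < c ∧ ∀ᵐ x ∂μ, c ≤ γ x) :
    ∃ (y₁ w₁ y₂ w₂ : ℝ → ℂ) (c : ℂ),
      IsFundamental (invCoeff γ) (shiftCoeff γ₀ z) y₁ w₁ y₂ w₂ ∧ y₁ Real.pi = 0 ∧ c ≠ 0 ∧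
      toComplex φ =ᵐ[μ] fun x => c * y₁ x := by
  obtain ⟨y₁, w₁, y₂, w₂, F⟩ := exists_isFundamental γ₀ hγ z
  obtain ⟨c, hc, he⟩ := (mem_scalarGraph_smul_iff hγ F).1 hφ.mem_graph
  have hc0 : c ≠ 0 := by
    rintro rfl
    refine hφ.ne_zero ((Lp.eq_zero_iff_ae_eq_zero).2 (he.trans ?_))
    exact Filter.Eventually.of_forall fun x => zero_mul _
  exact ⟨y₁, w₁, y₂, w₂, c, F, (mul_eq_zero.1 hc).resolve_left hc0, hc0, he⟩

theorem IsNormalizedEigenfunction.eq_smul (hφ : IsNormalizedEigenfunction γ γ₀ z φ)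
    (hγ : ∃ c : ℝ, 0 < c ∧ ∀ᵐ x ∂μ, c ≤ γ x) {u : L2} (hu : (u, z • u) ∈ scalarGraph γ γ₀) :
    ∃ c : ℂ, u = c • toComplex φ := by
  obtain ⟨y₁, w₁, y₂, w₂, c, F, hpi, hc, he⟩ := hφ.exists_fundamental hγ
  obtain ⟨k, -, hk⟩ := (mem_scalarGraph_smul_iff hγ F).1 hu
  refine ⟨k / c, Lp.ext ?_⟩
  filter_upwards [he, hk, Lp.coeFn_smul (k / c) (toComplex φ)] with x h₁ h₂ h₃
  rw [h₃, Pi.smul_apply, h₁, h₂, smul_eq_mul]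
  field_simp

theorem IsNormalizedEigenfunction.solvable_iff (hφ : IsNormalizedEigenfunction γ γ₀ z φ)
    (hγ : ∃ c : ℝ, 0 < c ∧ ∀ᵐ x ∂μ, c ≤ γ x) {f : L2} :
    (∃ u : L2, (u, f + z • u) ∈ scalarGraph γ γ₀) ↔ ∫ x, toComplex φ x * f x ∂μ = 0 := by
  obtain ⟨y₁, w₁, y₂, w₂, c, F, hpi, hc, he⟩ := hφ.exists_fundamental hγ
  have e : ∫ x, toComplex φ x * f x ∂μ = c * ∫ x, y₁ x * f x ∂μ := by
    rw [← integral_const_mul]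
    refine integral_congr_ae (he.mono fun x hx => ?_)
    simp only [hx, mul_assoc]
  rw [exists_mem_scalarGraph_iff hγ F hpi, e, mul_eq_zero, or_iff_right hc]

theorem IsNormalizedEigenfunction.integral_mul_self (hφ : IsNormalizedEigenfunction γ γ₀ z φ) :
    ∫ x, toComplex φ x * toComplex φ x ∂μ = 1 := by
  have h : inner ℝ φ φ = 1 := by
    rw [real_inner_self_eq_norm_sq, hφ.2, one_pow]
  rw [L2.inner_def] at h
  rw [← Complex.ofReal_one, ← h, ← integral_complex_ofReal]
  refine integral_congr_ae ?_
  filter_upwards [toComplex_ae φ] with x hx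
  rw [hx, ← Complex.ofReal_mul]
  rfl

/-- As `φ` is real, the integral is that of `φ²`, and unique continuation applies. This makes the
condition on `ω` fix the multiple of `φ` in `ψ`. -/
theorem IsNormalizedEigenfunction.setIntegral_mul_self_ne_zero
    (hφ : IsNormalizedEigenfunction γ γ₀ z φ) (hγ : ∃ c : ℝ, 0 < c ∧ ∀ᵐ x ∂μ, c ≤ γ x)
    {ω : Set ℝ} (hω : IsOpen ω) (hne : ω.Nonempty) (hsub : ω ⊆ Ioo 0 Real.pi) :
    ∫ x in ω, (φ x : ℂ) * toComplex φ x ≠ 0 := by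
  intro h
  obtain ⟨y₁, w₁, y₂, w₂, c, F, hpi, hc, he⟩ := hφ.exists_fundamental hγ
  have hle : volume.restrict ω ≤ μ := Measure.restrict_mono hsub le_rfl
  have hac : ∀ {P : ℝ → Prop}, (∀ᵐ x ∂μ, P x) → ∀ᵐ x ∂volume.restrict ω, P x :=
    fun hP => ae_mono hle hP
  have e : ∫ x in ω, (φ x : ℂ) * toComplex φ x = ((∫ x in ω, φ x ^ 2 : ℝ) : ℂ) := by
    rw [← integral_complex_ofReal]
    refine integral_congr_ae ((hac (toComplex_ae φ)).mono fun x hx => ?_)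
    simp only [hx]
    push_cast
    ring
  have hi : Integrable (fun x => φ x ^ 2) μ := (Lp.memLp φ).integrable_sq
  rw [e, Complex.ofReal_eq_zero, integral_eq_zero_iff_of_nonneg (fun x => by positivity)
    (hi.mono_measure hle)] at h
  refine F.not_ae_eq_zero hγ hω hne hsub ?_
  filter_upwards [h, hac he, hac (toComplex_ae φ)] with x h₁ h₂ h₃
  have h₄ : φ x = 0 := by simpa using h₁
  rw [h₃, h₄, Complex.ofReal_zero] at h₂
  exact (mul_eq_zero.1 h₂.symm).resolve_left hc

theorem IsNormalizedEigenfunction.exists_isWeakDeriv (hφ : IsNormalizedEigenfunction γ γ₀ z φ)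
    {p dp : LInf} (hp : IsWeakDeriv p dp) :
    ∃ d : L2, IsWeakDeriv (coeffMul p (toComplex φ)) d := by
  obtain ⟨v, hv, -⟩ := hφ.mem_graph
  exact ⟨_, hp.coeffMul (isWeakDeriv_of_mem_H10 hv)⟩

/-- Expanding `(p φ)' = p' φ + p φ'` and using `2 ∫ p φ φ' = -∫ p' φ²` leaves `∫ (p' / 2 - q) φ²`.
It is the obstruction to solving the first row. -/
theorem IsNormalizedEigenfunction.integral_coupling (hφ : IsNormalizedEigenfunction γ γ₀ z φ)
    {p dp : LInf} (hp : IsWeakDeriv p dp) (q : LInf) {d : L2}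
    (hd : IsWeakDeriv (coeffMul p (toComplex φ)) d) :
    ∫ x, toComplex φ x * (d - coeffMul q (toComplex φ) : L2) x ∂μ
      = -(couplingIntegral dp q φ : ℂ) := by
  obtain ⟨v, hv, -⟩ := hφ.mem_graph
  obtain rfl := hd.unique (hp.coeffMul (isWeakDeriv_of_mem_H10 hv))
  have key := integral_mul_deriv_coeffMul hp hv
  change ∫ x, toComplex φ x * coeffMul dp (toComplex φ) x ∂μ + _ = 0 at key
  have hJ : (couplingIntegral dp q φ : ℂ) = ∫ x, toComplex φ x * coeffMul q (toComplex φ) x ∂μ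
      + (-(1 / 2 : ℂ)) * ∫ x, toComplex φ x * coeffMul dp (toComplex φ) x ∂μ := by
    rw [couplingIntegral, ← integral_complex_ofReal, ← integral_const_mul,
      ← integral_add (integrable_mul_L2 _ _) ((integrable_mul_L2 _ _).const_mul _)]
    refine integral_congr_ae ?_
    filter_upwards [toComplex_ae φ, coeffMul_ae q (toComplex φ), coeffMul_ae dp (toComplex φ)]
      with x h₁ h₂ h₃
    rw [h₂, h₃, h₁]
    push_cast
    ring
  rw [sub_eq_add_neg, ← neg_one_smul ℂ (coeffMul q (toComplex φ)), integral_mul_add,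
    integral_mul_add, integral_mul_smul, hJ]
  linear_combination (1 / 2 : ℂ) * key

/-- The equation for `ψ`, in terms of the graph of the scalar operator. -/
theorem isPsi_iff {p dp q : LInf} {ω : Set ℝ} {d : L2}
    (hd : IsWeakDeriv (coeffMul p (toComplex φ)) d) {ψ : L2} :
    IsPsi γ γ₀ p dp q ω z φ ψ ↔
      (ψ, (d - coeffMul q (toComplex φ) + (couplingIntegral dp q φ : ℂ) • toComplex φ) + z • ψ)
        ∈ scalarGraph γ γ₀ ∧ ∫ x in ω, (φ x : ℂ) * ψ x = 0 := by
  rw [← scalarOp_graph, mem_graph_add_smul_iff, IsPsi]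
  refine and_congr_left fun _ => exists_congr fun hψ => ⟨?_, fun h => ⟨d, hd, h⟩⟩
  rintro ⟨d', hd', h⟩
  rw [hd.unique hd']
  exact h

theorem existsUnique_isPsi (hφ : IsNormalizedEigenfunction γ γ₀ z φ)
    (hγ : ∃ c : ℝ, 0 < c ∧ ∀ᵐ x ∂μ, c ≤ γ x) {p dp : LInf} (hp : IsWeakDeriv p dp) (q : LInf)
    {ω : Set ℝ} (hω : IsOpen ω) (hne : ω.Nonempty) (hsub : ω ⊆ Ioo 0 Real.pi) :
    ∃! ψ : L2, IsPsi γ γ₀ p dp q ω z φ ψ := by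
  obtain ⟨d, hd⟩ := hφ.exists_isWeakDeriv hp
  have hN := hφ.setIntegral_mul_self_ne_zero hγ hω hne hsub
  have hle : volume.restrict ω ≤ μ := Measure.restrict_mono hsub le_rfl
  have hφm : MemLp (fun x => (φ x : ℂ)) 2 μ := (Lp.memLp φ).ofReal
  have hint : ∀ u : L2, Integrable (fun x => (φ x : ℂ) * u x) (volume.restrict ω) := fun u =>
    (hφm.integrable_mul (Lp.memLp u)).mono_measure hle
  have hlin : ∀ (u : L2) (c : ℂ), ∫ x in ω, (φ x : ℂ) * (u + c • toComplex φ : L2) x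
      = (∫ x in ω, (φ x : ℂ) * u x) + c * ∫ x in ω, (φ x : ℂ) * toComplex φ x := by
    intro u c
    rw [← integral_const_mul, ← integral_add (hint u) ((hint _).const_mul c)]
    refine integral_congr_ae ?_
    filter_upwards [ae_mono hle (Lp.coeFn_add u (c • toComplex φ)),
      ae_mono hle (Lp.coeFn_smul c (toComplex φ))] with x h₁ h₂
    rw [h₁, Pi.add_apply, h₂, Pi.smul_apply, smul_eq_mul]
    ring
  set f : L2 := d - coeffMul q (toComplex φ) + (couplingIntegral dp q φ : ℂ) • toComplex φ with hf
  -- The added multiple of `φ` cancels the obstruction, because `∫ φ² = 1`.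
  obtain ⟨u, hu⟩ := (hφ.solvable_iff hγ (f := f)).2 (by
    rw [hf, integral_mul_add, integral_mul_smul, hφ.integral_mul_self,
      hφ.integral_coupling hp q hd]
    ring)
  have hadd : ∀ c : ℂ, (u + c • toComplex φ, f + z • (u + c • toComplex φ)) ∈ scalarGraph γ γ₀ := by
    intro c
    convert add_mem hu ((scalarGraph γ γ₀).smul_mem c hφ.mem_graph) using 1
    refine Prod.ext rfl ?_
    simp only [Prod.smul_mk, Prod.mk_add_mk, smul_add, smul_comm c z]
    abel
  -- The coefficient removes the component of `u` along `φ` in `L²(ω)`.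
  refine ⟨u + (-(∫ x in ω, (φ x : ℂ) * u x) / ∫ x in ω, (φ x : ℂ) * toComplex φ x) • toComplex φ,
    (isPsi_iff hd).2 ⟨hadd _, ?_⟩, fun ψ hψ => ?_⟩
  · rw [hlin, div_mul_cancel₀ _ hN, add_neg_cancel]
  · obtain ⟨h₁, h₂⟩ := (isPsi_iff hd).1 hψ
    obtain ⟨c, hc⟩ := hφ.eq_smul hγ (u := ψ - u) (by
      convert sub_mem h₁ hu using 1
      refine Prod.ext rfl ?_
      simp only [Prod.mk_sub_mk, smul_sub, hf]
      abel)
    obtain rfl : ψ = u + c • toComplex φ := by rw [← hc]; abel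
    rw [hlin] at h₂
    congr 2
    rw [eq_div_iff hN]
    linear_combination h₂

end Eigenfunction

/-! ### The coupled operator -/

section Adjoint

variable {γ γ₀ p dp q : LInf} {z : ℂ}

theorem L2Pair_ext {x y : L2Pair} (h₁ : x.fst = y.fst) (h₂ : x.snd = y.snd) : x = y :=
  WithLp.ofLp_injective 2 (Prod.ext h₁ h₂)

theorem mem_adjointGraph_iff {x y : L2Pair} : (x, y) ∈ adjointGraph γ γ₀ p q ↔
    ∃ d : L2, IsWeakDeriv (coeffMul p x.snd) d ∧
      (x.fst, y.fst - coeffMul q x.snd + d) ∈ scalarGraph γ γ₀ ∧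
      (x.snd, y.snd) ∈ scalarGraph γ γ₀ := by
  constructor
  · rintro ⟨g, d, h₁, h₂, h₃, h₄⟩
    refine ⟨d, h₃, ?_, h₂⟩
    change y.fst = g + coeffMul q x.snd - d at h₄
    rw [h₄]
    convert h₁ using 2
    abel
  · rintro ⟨d, h₃, h₁, h₂⟩
    refine ⟨_, d, h₁, h₂, h₃, ?_⟩
    change y.fst = y.fst - coeffMul q x.snd + d + coeffMul q x.snd - d
    abel

theorem mem_adjointGraph_add_smul_iff {x y : L2Pair} {d : L2}
    (hd : IsWeakDeriv (coeffMul p x.snd) d) :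
    (x, y + z • x) ∈ adjointGraph γ γ₀ p q ↔
      (x.fst, (y.fst - coeffMul q x.snd + d) + z • x.fst) ∈ scalarGraph γ γ₀ ∧
      (x.snd, y.snd + z • x.snd) ∈ scalarGraph γ γ₀ := by
  rw [mem_adjointGraph_iff]
  have e : ∀ d' : L2, (y + z • x).fst - coeffMul q x.snd + d'
      = (y.fst - coeffMul q x.snd + d') + z • x.fst := by
    intro d'
    change y.fst + z • x.fst - coeffMul q x.snd + d' = _
    abel
  simp only [e]
  constructor
  · rintro ⟨d', hd', h⟩
    rw [hd.unique hd']
    exact h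
  · exact fun h => ⟨d, hd, h⟩

theorem isWeakDeriv_coeffMul_zero (p : LInf) : IsWeakDeriv (coeffMul p 0) (0 : L2) := by
  rw [coeffMul_zero]
  exact isWeakDeriv_zero

theorem isEigenvector_adjointOp_iff {x : L2Pair} :
    IsEigenvector (adjointOp γ γ₀ p q) z x ↔ (x, z • x) ∈ adjointGraph γ γ₀ p q ∧ x ≠ 0 := by
  rw [IsEigenvector, mem_eigenspace_iff, adjointOp_graph]

theorem pair_zero_smul_mem {u : L2} (hu : (u, z • u) ∈ scalarGraph γ γ₀) :
    (pair u 0, z • pair u 0) ∈ adjointGraph γ γ₀ p q := by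
  have h := (mem_adjointGraph_add_smul_iff (γ := γ) (γ₀ := γ₀) (q := q) (z := z) (x := pair u 0)
    (y := 0) (isWeakDeriv_coeffMul_zero p)).2
  rw [zero_add] at h
  refine h ⟨?_, ?_⟩
  · change (u, ((0 : L2) - coeffMul q 0 + 0) + z • u) ∈ _
    rw [coeffMul_zero, sub_zero, add_zero, zero_add]
    exact hu
  · change ((0 : L2), (0 : L2) + z • (0 : L2)) ∈ _
    rw [smul_zero, add_zero]
    exact zero_mem _

theorem eigenvalues_scalarOp_subset :
    eigenvalues (scalarOp γ γ₀) ⊆ eigenvalues (adjointOp γ γ₀ p q) := by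
  rintro z ⟨u, hu⟩
  obtain ⟨hu, hne⟩ := isEigenvector_scalarOp_iff.1 hu
  refine ⟨pair u 0, isEigenvector_adjointOp_iff.2 ⟨pair_zero_smul_mem hu, fun h => hne ?_⟩⟩
  exact congrArg WithLp.fst h

/-- By triangularity, the second component of an eigenvector is an eigenfunction of `L` or zero; in
the latter case the first one is an eigenfunction. -/
theorem eigenvalues_adjointOp_subset :
    eigenvalues (adjointOp γ γ₀ p q) ⊆ eigenvalues (scalarOp γ γ₀) := by
  rintro z ⟨x, hx⟩
  obtain ⟨hx, hne⟩ := isEigenvector_adjointOp_iff.1 hx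
  obtain ⟨d, hd, h₁, h₂⟩ := mem_adjointGraph_iff.1 hx
  by_cases h : x.snd = 0
  · refine ⟨x.fst, isEigenvector_scalarOp_iff.2 ⟨?_, fun h' => hne (L2Pair_ext h' h)⟩⟩
    rw [h] at hd h₁
    rw [hd.unique (isWeakDeriv_coeffMul_zero p), coeffMul_zero, sub_zero, add_zero] at h₁
    exact h₁
  · exact ⟨x.snd, isEigenvector_scalarOp_iff.2 ⟨h₂, h⟩⟩

theorem spectrum_adjointOp_subset (hγ : ∃ c : ℝ, 0 < c ∧ ∀ᵐ x ∂μ, c ≤ γ x)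
    (hp : IsWeakDeriv p dp) :
    spectrum (adjointOp γ γ₀ p q) ⊆ eigenvalues (scalarOp γ γ₀) := by
  intro z hz
  by_contra h
  obtain ⟨R, D, hRD⟩ := exists_resolvent hγ h
  let e : L2Pair ≃L[ℂ] L2 × L2 := WithLp.prodContinuousLinearEquiv 2 ℂ L2 L2
  -- `S` is the bounded operator `y ↦ (p R y)'`, by the product rule. Back substitution is `u₂ = R
  -- y₂`, `u₁ = R (y₁ - q u₂ + S y₂)`.
  let S : L2 →L[ℂ] L2 := coeffMulCLM dp ∘L R + coeffMulCLM p ∘L D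
  let fst : L2Pair →L[ℂ] L2 := ContinuousLinearMap.fst ℂ L2 L2 ∘L e.toContinuousLinearMap
  let snd : L2Pair →L[ℂ] L2 := ContinuousLinearMap.snd ℂ L2 L2 ∘L e.toContinuousLinearMap
  let Q : L2Pair →L[ℂ] L2Pair := e.symm.toContinuousLinearMap ∘L
    (R ∘L (fst - coeffMulCLM q ∘L R ∘L snd + S ∘L snd)).prod (R ∘L snd)
  refine notMem_spectrum Q (fun y => ?_) (fun h' => h (eigenvalues_adjointOp_subset h')) hz
  rw [adjointOp_graph]
  exact (mem_adjointGraph_add_smul_iff (x := Q y) (d := S y.snd) (hp.coeffMul (hRD y.snd).2)).2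
    ⟨(hRD (y.fst - coeffMul q (R y.snd) + S y.snd)).1, (hRD y.snd).1⟩

/-- The eigenspace of the coupled operator at an eigenvalue of the scalar operator. -/
theorem IsNormalizedEigenfunction.exists_of_mem_eigenspace {φ : L2R}
    (hφ : IsNormalizedEigenfunction γ γ₀ z φ) (hγ : ∃ c : ℝ, 0 < c ∧ ∀ᵐ x ∂μ, c ≤ γ x)
    (hp : IsWeakDeriv p dp) {ω : Set ℝ} {ψ : L2} (hψ : IsPsi γ γ₀ p dp q ω z φ ψ) {x : L2Pair}
    (hx : x ∈ eigenspace (adjointOp γ γ₀ p q) z) :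
    ∃ a c : ℂ, c * couplingIntegral dp q φ = 0 ∧
      x = a • pair (toComplex φ) 0 + c • pair ψ (toComplex φ) := by
  rw [mem_eigenspace_iff, adjointOp_graph, mem_adjointGraph_iff] at hx
  obtain ⟨d', hd', h₁, h₂⟩ := hx
  obtain ⟨d, hd⟩ := hφ.exists_isWeakDeriv hp
  obtain ⟨c, hc⟩ := hφ.eq_smul hγ h₂
  have hcd : IsWeakDeriv (coeffMul p x.snd) (c • d : L2) := by
    rw [hc, coeffMul_smul]
    exact hd.smul c
  obtain rfl := hd'.unique hcd
  have e : (z • x).fst - coeffMul q x.snd + c • d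
      = c • (d - coeffMul q (toComplex φ)) + z • x.fst := by
    change z • x.fst - coeffMul q x.snd + c • d = _
    rw [hc, coeffMul_smul, smul_sub]
    abel
  rw [e] at h₁
  -- The first row is an equation for `x.fst` with source `c ((p φ)' - q φ)`, so solvability forces
  -- this product to vanish.
  have hJ : c * (couplingIntegral dp q φ : ℂ) = 0 := by
    have := (hφ.solvable_iff hγ).1 ⟨_, h₁⟩
    rw [integral_mul_smul, hφ.integral_coupling hp q hd, mul_neg, neg_eq_zero] at this
    exact this
  -- Once `c I = 0`, `c ψ` solves the same equation as `x.fst`, so their difference lies in the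
  -- kernel of `L - z`.
  obtain ⟨a, ha⟩ := hφ.eq_smul hγ (u := x.fst - c • ψ) (by
    convert sub_mem h₁ ((scalarGraph γ γ₀).smul_mem c ((isPsi_iff hd).1 hψ).1) using 1
    refine Prod.ext rfl ?_
    simp only [Prod.smul_mk, Prod.mk_sub_mk, smul_add, smul_sub, smul_smul, hJ, zero_smul,
      mul_comm c z]
    abel)
  refine ⟨a, c, hJ, L2Pair_ext ?_ ?_⟩
  · change x.fst = a • toComplex φ + c • ψ
    rw [← ha]
    abel
  · change x.snd = a • (0 : L2) + c • toComplex φ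
    rw [hc, smul_zero, zero_add]

theorem IsNormalizedEigenfunction.pair_mem_adjointGraph {φ : L2R}
    (hφ : IsNormalizedEigenfunction γ γ₀ z φ) (hp : IsWeakDeriv p dp) {ω : Set ℝ} {ψ : L2}
    (hψ : IsPsi γ γ₀ p dp q ω z φ ψ) :
    (pair ψ (toComplex φ), (couplingIntegral dp q φ : ℂ) • pair (toComplex φ) 0
      + z • pair ψ (toComplex φ)) ∈ adjointGraph γ γ₀ p q := by
  obtain ⟨d, hd⟩ := hφ.exists_isWeakDeriv hp
  refine (mem_adjointGraph_add_smul_iff (x := pair ψ (toComplex φ)) hd).2 ⟨?_, ?_⟩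
  · convert ((isPsi_iff hd).1 hψ).1 using 1
    refine Prod.ext rfl ?_
    change (couplingIntegral dp q φ : ℂ) • toComplex φ - coeffMul q (toComplex φ) + d + z • ψ
      = (d - coeffMul q (toComplex φ) + (couplingIntegral dp q φ : ℂ) • toComplex φ) + z • ψ
    abel
  · change (toComplex φ, (couplingIntegral dp q φ : ℂ) • (0 : L2) + z • toComplex φ) ∈ _
    rw [smul_zero, zero_add]
    exact hφ.mem_graph

end Adjoint

/-! ### Geometric multiplicity and the Jordan chain -/

section Multiplicity

variable {γ γ₀ p dp q : LInf} {z : ℂ} {φ : L2R} {ω : Set ℝ} {ψ : L2}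

theorem IsNormalizedEigenfunction.pair_ne_zero (hφ : IsNormalizedEigenfunction γ γ₀ z φ) :
    pair (toComplex φ) 0 ≠ 0 :=
  fun h => hφ.ne_zero (congrArg WithLp.fst h)

theorem IsNormalizedEigenfunction.isEigenvector_pair (hφ : IsNormalizedEigenfunction γ γ₀ z φ) :
    IsEigenvector (adjointOp γ γ₀ p q) z (pair (toComplex φ) 0) :=
  isEigenvector_adjointOp_iff.2 ⟨pair_zero_smul_mem hφ.mem_graph, hφ.pair_ne_zero⟩

theorem IsNormalizedEigenfunction.isEigenvector_pair_psi
    (hφ : IsNormalizedEigenfunction γ γ₀ z φ) (hp : IsWeakDeriv p dp)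
    (hψ : IsPsi γ γ₀ p dp q ω z φ ψ) (hJ : couplingIntegral dp q φ = 0) :
    IsEigenvector (adjointOp γ γ₀ p q) z (pair ψ (toComplex φ)) := by
  have h := hφ.pair_mem_adjointGraph hp hψ
  rw [hJ, Complex.ofReal_zero, zero_smul, zero_add] at h
  exact isEigenvector_adjointOp_iff.2 ⟨h, fun h' => hφ.ne_zero (congrArg WithLp.snd h')⟩

/-- A nonzero coupling integral forces the coefficient of `(ψ, φ)` to be zero. -/
theorem geometricMultiplicity_eq_one (hφ : IsNormalizedEigenfunction γ γ₀ z φ)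
    (hγ : ∃ c : ℝ, 0 < c ∧ ∀ᵐ x ∂μ, c ≤ γ x) (hp : IsWeakDeriv p dp)
    (hψ : IsPsi γ γ₀ p dp q ω z φ ψ) (hJ : couplingIntegral dp q φ ≠ 0) :
    geometricMultiplicity (adjointOp γ γ₀ p q) z = 1 := by
  have e : eigenspace (adjointOp γ γ₀ p q) z = Submodule.span ℂ {pair (toComplex φ) 0} := by
    refine le_antisymm (fun x hx => ?_) ?_
    · obtain ⟨a, c, hc, rfl⟩ := hφ.exists_of_mem_eigenspace hγ hp hψ hx
      obtain rfl := (mul_eq_zero.1 hc).resolve_right (Complex.ofReal_ne_zero.2 hJ)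
      rw [zero_smul, add_zero]
      exact Submodule.smul_mem _ _ (Submodule.mem_span_singleton_self _)
    · rw [Submodule.span_singleton_le_iff_mem]
      exact hφ.isEigenvector_pair.1
  rw [geometricMultiplicity, e, finrank_span_singleton hφ.pair_ne_zero]

theorem geometricMultiplicity_eq_two (hφ : IsNormalizedEigenfunction γ γ₀ z φ)
    (hγ : ∃ c : ℝ, 0 < c ∧ ∀ᵐ x ∂μ, c ≤ γ x) (hp : IsWeakDeriv p dp)
    (hψ : IsPsi γ γ₀ p dp q ω z φ ψ) (hJ : couplingIntegral dp q φ = 0) :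
    geometricMultiplicity (adjointOp γ γ₀ p q) z = 2 := by
  have e : eigenspace (adjointOp γ γ₀ p q) z
      = Submodule.span ℂ (range ![pair (toComplex φ) 0, pair ψ (toComplex φ)]) := by
    rw [Matrix.range_cons_cons_empty]
    refine le_antisymm (fun x hx => ?_) ?_
    · obtain ⟨a, c, -, rfl⟩ := hφ.exists_of_mem_eigenspace hγ hp hψ hx
      exact Submodule.mem_span_pair.2 ⟨a, c, rfl⟩
    · rw [Submodule.span_le, insert_subset_iff, singleton_subset_iff]
      exact ⟨hφ.isEigenvector_pair.1, (hφ.isEigenvector_pair_psi hp hψ hJ).1⟩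
  have hli : LinearIndependent ℂ ![pair (toComplex φ) 0, pair ψ (toComplex φ)] := by
    rw [LinearIndependent.pair_iff]
    intro s t hst
    -- The second component sees only `t`, because `(φ, 0)` has none.
    have h₂ : s • (0 : L2) + t • toComplex φ = 0 := congrArg WithLp.snd hst
    rw [smul_zero, zero_add] at h₂
    have ht := (smul_eq_zero.1 h₂).resolve_right hφ.ne_zero
    rw [ht, zero_smul, add_zero] at hst
    exact ⟨(smul_eq_zero.1 hst).resolve_right hφ.pair_ne_zero, ht⟩
  rw [geometricMultiplicity, e, finrank_span_eq_card hli, Fintype.card_fin]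

end Multiplicity

end Cascade

theorem mainTheorem4
    (γ γ₀ p dp q : Cascade.LInf)
    (hγ : ∃ c : ℝ, 0 < c ∧ ∀ᵐ x ∂Cascade.μ, c ≤ γ x)
    (hp : Cascade.IsWeakDeriv p dp)
    (ω : Set ℝ) (hω_open : IsOpen ω) (hω_nonempty : ω.Nonempty)
    (hω_sub : ω ⊆ Set.Ioo 0 Real.pi) :
    UnboundedOp.spectrum (Cascade.adjointOp γ γ₀ p q)
        = UnboundedOp.spectrum (Cascade.scalarOp γ γ₀) ∧
    UnboundedOp.spectrum (Cascade.scalarOp γ γ₀)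
        = UnboundedOp.eigenvalues (Cascade.scalarOp γ γ₀) ∧
    UnboundedOp.spectrum (Cascade.adjointOp γ γ₀ p q)
        = UnboundedOp.eigenvalues (Cascade.adjointOp γ γ₀ p q) ∧
    ∀ z ∈ UnboundedOp.eigenvalues (Cascade.scalarOp γ γ₀),
      (∃ φ : Cascade.L2R, Cascade.IsNormalizedEigenfunction γ γ₀ z φ) ∧
      ∀ φ : Cascade.L2R, Cascade.IsNormalizedEigenfunction γ γ₀ z φ →
        (∃! ψ : Cascade.L2, Cascade.IsPsi γ γ₀ p dp q ω z φ ψ) ∧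
        ∀ ψ : Cascade.L2, Cascade.IsPsi γ γ₀ p dp q ω z φ ψ →
          let A := Cascade.adjointOp γ γ₀ p q
          let Φ := Cascade.pair (Cascade.toComplex φ) 0
          let Ψ := Cascade.pair ψ (Cascade.toComplex φ)
          let J := Cascade.couplingIntegral dp q φ
          (UnboundedOp.geometricMultiplicity A z = 1 ↔ J ≠ 0) ∧
          (J ≠ 0 →
            UnboundedOp.IsEigenvector A z Φ ∧
            UnboundedOp.IsGeneralizedEigenvector A z Ψ ∧
            ∃ hΨ : Ψ ∈ A.domain, A ⟨Ψ, hΨ⟩ - z • Ψ = (J : ℂ) • Φ) ∧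
          (UnboundedOp.geometricMultiplicity A z = 2 ↔ J = 0) ∧
          (J = 0 →
            UnboundedOp.IsEigenvector A z Φ ∧
            UnboundedOp.IsEigenvector A z Ψ) := by
  have hS := Cascade.spectrum_scalarOp (γ₀ := γ₀) hγ
  have hA := Cascade.spectrum_adjointOp_subset (γ₀ := γ₀) (q := q) hγ hp
  have hle := Cascade.eigenvalues_scalarOp_subset (γ := γ) (γ₀ := γ₀) (p := p) (q := q)
  have hge := UnboundedOp.eigenvalues_subset_spectrum (T := Cascade.adjointOp γ γ₀ p q)
  -- The inclusions close up: eigenvalues of `L`, eigenvalues of `A`, spectrum of `A`, eigenvalues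
  -- of `L`.
  refine ⟨(hA.trans_eq hS.symm).antisymm (hS.subset.trans (hle.trans hge)), hS,
    (hA.trans hle).antisymm hge,
    fun z hz => ⟨Cascade.exists_isNormalizedEigenfunction hγ hz, fun φ hφ =>
      ⟨Cascade.existsUnique_isPsi hφ hγ hp q hω_open hω_nonempty hω_sub, fun ψ hψ => ?_⟩⟩⟩
  have h₁ := Cascade.geometricMultiplicity_eq_one hφ hγ hp hψ
  have h₂ := Cascade.geometricMultiplicity_eq_two hφ hγ hp hψ
  have hΦ := hφ.isEigenvector_pair (p := p) (q := q)
  intro A Φ Ψ J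
  refine ⟨⟨fun h hJ => ?_, h₁⟩, fun hJ => ?_, ⟨fun h => ?_, h₂⟩,
    fun hJ => ⟨hΦ, hφ.isEigenvector_pair_psi hp hψ hJ⟩⟩
  -- Each converse holds because the opposite case gives the other dimension.
  · rw [h₂ hJ] at h
    omega
  · have hm := hφ.pair_mem_adjointGraph hp hψ
    rw [← Cascade.adjointOp_graph, UnboundedOp.mem_graph_add_smul_iff] at hm
    obtain ⟨hΨ, e⟩ := hm
    refine ⟨hΦ, ⟨hΨ, ?_⟩, hΨ, e⟩
    rw [e]
    exact ⟨Submodule.smul_mem _ _ hΦ.1, smul_ne_zero (Complex.ofReal_ne_zero.2 hJ) hΦ.2⟩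
  · by_contra hJ
    rw [h₁ hJ] at h
    omega
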